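/- **Setting.** Let $k$ be a commutative ring, $I$ an injective cogenerator of $\operatorname{Mod} k$, and $R$ a $k$-algebra (for an arbitrary ring one may take $k=\mathbb Z$). Put $(-)^*=\operatorname{Hom}_k(-,I)$, which turns $R^{op}$-modules into $R$-modules; $(-)^\vee=\operatorname{Hom}_R(-,R)$ (respectively $\operatorname{Hom}_{R^{op}}(-,R)$), which interchanges $R$-modules and $R^{op}$-modules; and $\nu=((-)^\vee)^*$. These functors are extended termwise to complexes and to homotopy categories. Let $K(\operatorname{Inj}R)$ and $K(\operatorname{Proj}R)$ be the full subcategories of the homotopy category $K(\operatorname{Mod}R)$ of unbounded complexes consisting of the complexes of injective, respectively projective, modules. Let $\lambda$ denote the left adjoint of the inclusion $K(\operatorname{Inj}R)\hookrightarrow K(\operatorname{Mod}R)$ and $\rho$ the right adjoint of $K(\operatorname{Proj}R)\hookrightarrow K(\operatorname{Mod}R)$, on the objects where they are defined: $\lambda X$ corepresents $\operatorname{Hom}_K(X,-)$ on $K(\operatorname{Inj}R)$ and $\rho X$ represents $\operatorname{Hom}_K(-,X)$ on $K(\operatorname{Proj}R)$; the same notation is used for $R^{op}$. Let $K^b_{fpr}(R)$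 be the full subcategory of $K(\operatorname{Mod}R)$ of bounded complexes $X$ that admit a quasi-isomorphism $P\to X$ with $P$ a right bounded complex of finitely generated projective $R$-modules. A *partial Serre functor* for a full subcategory $\mathcal X$ of a $k$-linear category $\mathcal T$ is a functor $\mathbb S\colon\mathcal X\to\mathcal T$ together with isomorphisms of $k$-modules $\mathcal T(X,T)^*\cong\mathcal T(T,\mathbb SX)$, natural in $X\in\mathcal X$ and in $T\in\mathcal T$. **Theorem.** 1. The functors $\lambda$ and $\rho$ are defined on $K^b_{fpr}(R)$. Let $\lambda(K^b_{fpr}(R))$ be the essential image of $K^b_{fpr}(R)$ under $\lambda$, a full subcategory of $K(\operatorname{Inj}R)$. There is a partial Serre functor $\mathbb S\colon\lambda(K^b_{fpr}(R))\to K(\operatorname{Inj}R)$ given by $\mathbb S(\lambda X)\cong\nu\rho X$ in $K(\operatorname{Mod}R)$, naturally in $X\in K^b_{fpr}(R)$. 2. For $X\in K^b_{fpr}(R^{op})$ both $\rho X$ and $\rho(X^*)$ are defined, and $X\mapsto(\rho X)^\vee$ is, up to natural isomorphism, a functor $K^b_{fpr}(R^{op})^{op}\to K(\operatorname{Proj}R)$.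 Let $\rho(K^b_{fpr}(R^{op}))^\vee$ be its essential image, a full subcategory of $K(\operatorname{Proj}R)$. There is a partial Serre functor $\mathbb S\colon\rho(K^b_{fpr}(R^{op}))^\vee\to K(\operatorname{Proj}R)$ given by $\mathbb S((\rho X)^\vee)\cong\rho(X^*)$, naturally in $X\in K^b_{fpr}(R^{op})$. -/

import Mathlib

open CategoryTheory Opposite
open scoped ModuleCat.Algebra

universe w u

namespace PartialSerre

/-! ### Partial Serre functors -/

section Serre

universe v₁ u₁ v₂

variable (k : Type w) [CommRing k] (I : ModuleCat.{v₂} k)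
variable {T : Type u₁} [Category.{v₁} T] [Preadditive T] [Linear k T]

/-- A partial Serre functor for the full subcategory `P` of the `k`-linear category `T`, with
respect to the dual `M ↦ Hom_k(M, I)`: a functor `S : P ⥤ T` together with `k`-linear isomorphisms
`Hom_k(T(X, Y), I) ≃ T(Y, S X)`, natural in `X` (an object of `P`) and in `Y` (an object of `T`). -/
structure PartialSerreFunctor (P : ObjectProperty T) where
  /-- the underlying functor -/
  functor : P.FullSubcategory ⥤ T
  /-- the duality isomorphism -/
  duality (X : P.FullSubcategory) (Y : T) :
    ((X.obj ⟶ Y) →ₗ[k] I) ≃ₗ[k] (Y ⟶ functor.obj X)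
  /-- naturality in the variable of `T` -/
  duality_naturality_right (X : P.FullSubcategory) {Y Y' : T} (g : Y ⟶ Y')
    (φ : (X.obj ⟶ Y) →ₗ[k] I) (φ' : (X.obj ⟶ Y') →ₗ[k] I)
    (h : ∀ a : X.obj ⟶ Y, φ a = φ' (a ≫ g)) :
    duality X Y φ = g ≫ duality X Y' φ'
  /-- naturality in the variable of `P` -/
  duality_naturality_left {X X' : P.FullSubcategory} (f : X ⟶ X') (Y : T)
    (φ : (X.obj ⟶ Y) →ₗ[k] I) (φ' : (X'.obj ⟶ Y) →ₗ[k] I)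
    (h : ∀ a : X'.obj ⟶ Y, φ' a = φ (f.hom ≫ a)) :
    duality X' Y φ' = duality X Y φ ≫ functor.map f

end Serre

/-! ### Contravariant additive functors on homotopy categories -/

section Contravariant

universe v₁ u₁ v₂ u₂

variable {C : Type u₁} [Category.{v₁} C] [Preadditive C]
variable {D : Type u₂} [Category.{v₂} D] [Preadditive D]

/-- The functor on complexes induced by a contravariant additive functor `F`: in degree `n`, the
complex `F X` is `F (X⁻ⁿ)`, with differentials `F (d)`; the target is the homotopy category. -/
noncomputable def contravariantComplex (F : Cᵒᵖ ⥤ D) [F.Additive] :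
    (CochainComplex C ℤ)ᵒᵖ ⥤ HomotopyCategory D (ComplexShape.up ℤ) :=
  (CochainComplex.opEquivalence C).functor ⋙ F.mapHomologicalComplex (ComplexShape.up ℤ) ⋙
    HomotopyCategory.quotient D (ComplexShape.up ℤ)

lemma contravariantComplex_map_eq (F : Cᵒᵖ ⥤ D) [F.Additive] {K L : CochainComplex C ℤ}
    {f g : K ⟶ L} (h : Homotopy f g) :
    (contravariantComplex F).map f.op = (contravariantComplex F).map g.op :=
  HomotopyCategory.eq_of_homotopy _ _ (F.mapHomotopy (CochainComplex.homotopyOp h))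

/-- The functor `K(C)ᵒᵖ ⥤ K(D)` induced by a contravariant additive functor from `C` to `D`. -/
noncomputable def contravariantK (F : Cᵒᵖ ⥤ D) [F.Additive] :
    (HomotopyCategory C (ComplexShape.up ℤ))ᵒᵖ ⥤ HomotopyCategory D (ComplexShape.up ℤ) :=
  (CategoryTheory.Quotient.lift (homotopic C (ComplexShape.up ℤ))
    (contravariantComplex F).rightOp (by
      rintro K L f g ⟨h⟩
      exact congrArg Quiver.Hom.op (contravariantComplex_map_eq F h))).leftOp

end Contravariant

/-! ### The two dualities of modules -/

section Dualities

/-- For an `(A, B)`-bimodule `Q` (`A` and `B` both act on `Q` by commuting actions), the functor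
`M ↦ Hom_A(M, Q)` from `A`-modules to `B`-modules, where `(b • f) x = b • f x`. -/
def homInto (A B Q : Type u) [Ring A] [Ring B] [AddCommGroup Q] [Module A Q] [Module B Q]
    [SMulCommClass A B Q] : (ModuleCat.{u} A)ᵒᵖ ⥤ ModuleCat.{u} B where
  obj M := ModuleCat.of B (M.unop →ₗ[A] Q)
  map f := ModuleCat.ofHom
    { toFun := fun φ => φ ∘ₗ f.unop.hom
      map_add' := fun _ _ => rfl
      map_smul' := fun _ _ => rfl }
  map_id _ := rfl
  map_comp _ _ := rfl

instance (A B Q : Type u) [Ring A] [Ring B] [AddCommGroup Q] [Module A Q] [Module B Q]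
    [SMulCommClass A B Q] : (homInto A B Q).Additive where
  map_add {_ _ f g} := by
    refine ModuleCat.hom_ext (LinearMap.ext fun φ => LinearMap.ext fun x => ?_)
    exact map_add (show _ →ₗ[A] Q from φ) (f.unop.hom x) (g.unop.hom x)

variable {k : Type w} [CommRing k] (I : ModuleCat.{u} k) (R : Type u) [Ring R] [Algebra k R]

/-- The left `R`-module structure on `Hom_k(N, I)`, for `N` a right `R`-module:
`(r • f) x = f (x r)`. -/
@[reducible]
def starModule (N : ModuleCat.{u} Rᵐᵒᵖ) : Module R (N →ₗ[k] I) where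
  smul r f :=
    { toFun := fun x => f (MulOpposite.op r • x)
      map_add' := fun x y => by rw [smul_add, map_add]
      map_smul' := fun c x => by rw [smul_comm, map_smul, RingHom.id_apply] }
  one_smul f := LinearMap.ext fun x => congrArg f (one_smul Rᵐᵒᵖ x)
  mul_smul r s f := LinearMap.ext fun x => congrArg f (mul_smul (MulOpposite.op s) _ x)
  smul_zero _ := rfl
  smul_add _ _ _ := rfl
  add_smul r s f := LinearMap.ext fun x =>
    (congrArg f (add_smul (MulOpposite.op r) (MulOpposite.op s) x)).trans (map_add f _ _)
  zero_smul f := LinearMap.ext fun x => (congrArg f (zero_smul Rᵐᵒᵖ x)).trans (map_zero f)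

/-- The functor `N ↦ N^* = Hom_k(N, I)` from right `R`-modules to left `R`-modules. -/
def star : (ModuleCat.{u} Rᵐᵒᵖ)ᵒᵖ ⥤ ModuleCat.{u} R where
  obj N := letI := starModule I R N.unop; ModuleCat.of R (N.unop →ₗ[k] I)
  map {N N'} f :=
    letI := starModule I R N.unop
    letI := starModule I R N'.unop
    ModuleCat.ofHom
      { toFun := fun φ =>
          { toFun := fun x => φ (f.unop.hom x)
            map_add' := fun x y => by rw [map_add, map_add]
            map_smul' := fun c x => by
              rw [RingHom.id_apply, ← map_smul φ]
              exact congrArg φ (map_smul f.unop.hom (algebraMap k Rᵐᵒᵖ c) x) }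
        map_add' := fun _ _ => rfl
        map_smul' := fun r φ => LinearMap.ext fun x =>
          congrArg φ (map_smul f.unop.hom (MulOpposite.op r) x).symm }
  map_id _ := rfl
  map_comp _ _ := rfl

instance : (star I R).Additive where
  map_add {N N' f g} := by
    let _ := starModule I R N.unop
    let _ := starModule I R N'.unop
    refine ModuleCat.hom_ext (LinearMap.ext fun φ => LinearMap.ext fun x => ?_)
    exact map_add (show N.unop →ₗ[k] I from φ) (f.unop.hom x) (g.unop.hom x)

end Dualities

/-! ### Homotopy categories of modules -/

section Homotopy

variable (R : Type u) [Ring R]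

/-- The homotopy category of (unbounded, cohomological) complexes of `R`-modules. -/
abbrev KMod := HomotopyCategory (ModuleCat.{u} R) (ComplexShape.up ℤ)

/-- The full subcategory `K(Inj R)` of `K(Mod R)`: complexes of injective modules. -/
def KInj : ObjectProperty (KMod R) := fun X => ∀ n : ℤ, Injective (X.as.X n)

/-- The full subcategory `K(Proj R)` of `K(Mod R)`: complexes of projective modules. -/
def KProj : ObjectProperty (KMod R) := fun X => ∀ n : ℤ, Projective (X.as.X n)

/-- The full subcategory of `K(Mod R)` of bounded complexes `X` which have a degreewise finitely
generated projective resolution: a quasi-isomorphism `P ⟶ X`, with `P` a right bounded complex of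
finitely generated projective modules. -/
def Kbfpr : ObjectProperty (KMod R) := fun X =>
  (∃ a b : ℤ, CochainComplex.IsStrictlyGE X.as a ∧ CochainComplex.IsStrictlyLE X.as b) ∧
    ∃ (P : CochainComplex (ModuleCat.{u} R) ℤ) (f : P ⟶ X.as),
      (∃ n : ℤ, P.IsStrictlyLE n) ∧
      (∀ n : ℤ, Projective (P.X n) ∧ Module.Finite R (P.X n)) ∧ QuasiIso f

/-- `λ X` is defined: `Hom_K(X, -)` is corepresentable on `K(Inj R)`, i.e. the left adjoint `λ` of
the inclusion `K(Inj R) ⥤ K(Mod R)` is defined at `X`. -/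
abbrev LamDefined : ObjectProperty (KMod R) := (KInj R).ι.leftAdjointObjIsDefined

/-- `ρ X` is defined: `Hom_K(-, X)` is representable on `K(Proj R)`, i.e. the right adjoint `ρ` of
the inclusion `K(Proj R) ⥤ K(Mod R)` is defined at `X`. -/
abbrev RhoDefined : ObjectProperty (KMod R) := (KProj R).ι.rightAdjointObjIsDefined

variable {R}

/-- The left adjoint `λ` of the inclusion `K(Inj R) ⥤ K(Mod R)`, on a full subcategory `P` of
`K(Mod R)` on which it is defined. -/
noncomputable def lam {P : ObjectProperty (KMod R)} (h : P ≤ LamDefined R) :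
    P.FullSubcategory ⥤ (KInj R).FullSubcategory :=
  ObjectProperty.ιOfLE h ⋙ (KInj R).ι.partialLeftAdjoint

/-- The right adjoint `ρ` of the inclusion `K(Proj R) ⥤ K(Mod R)`, on a full subcategory `P` of
`K(Mod R)` on which it is defined. -/
noncomputable def rho {P : ObjectProperty (KMod R)} (h : P ≤ RhoDefined R) :
    P.FullSubcategory ⥤ (KProj R).FullSubcategory :=
  ObjectProperty.ιOfLE h ⋙ (KProj R).ι.partialRightAdjoint

variable (R)

/-- `X ↦ X^∨ = Hom_R(X, R)`, from complexes of left `R`-modules to complexes of right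
`R`-modules. -/
noncomputable def veeK : (KMod R)ᵒᵖ ⥤ KMod Rᵐᵒᵖ := contravariantK (homInto R Rᵐᵒᵖ R)

/-- `Y ↦ Y^∨ = Hom_{Rᵒᵖ}(Y, R)`, from complexes of right `R`-modules to complexes of left
`R`-modules. -/
noncomputable def veeOpK : (KMod Rᵐᵒᵖ)ᵒᵖ ⥤ KMod R := contravariantK (homInto Rᵐᵒᵖ R R)

variable {k : Type w} [CommRing k] (I : ModuleCat.{u} k) [Algebra k R]

/-- `Y ↦ Y^* = Hom_k(Y, I)`, from complexes of right `R`-modules to complexes of left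
`R`-modules. -/
noncomputable def starK : (KMod Rᵐᵒᵖ)ᵒᵖ ⥤ KMod R := contravariantK (star I R)

/-- The functor `ν = ((-)^∨)^*` on complexes of left `R`-modules. -/
noncomputable def nuK : KMod R ⥤ KMod R := (veeK R).rightOp ⋙ starK R I

end Homotopy

end PartialSerre

/-! Both parts rest on one computation with finitely supported cochains. Suppose `V` and `W` are
complexes with linear forms on `Hom(V^n, W^n)` that identify `Hom(Y, W^n)` with `Hom(V^n, Y)^*`,
compatibly with differentials. For a complex `P` of finitely generated projectives, dual bases
provide such forms for `(P, ν P)` and for `(P^∨, P^*)` (`DualPair.isPerfect_tr`). The dual of a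
direct sum is the product of the duals, so the Hom complex from `Y` to `W` is dual to the complex of
finitely supported cochains from `V` to `Y`. Since `I` is injective, `(-)^*` is exact, and homotopy
classes `Y ⟶ W` are dual to the cohomology in degree zero of the finitely supported cochains.

For part 1 take a resolution `V = P ⟶ X` and `Y = J` in `K(Inj R)`. As `P` is bounded above, finite
support only means vanishing in low degrees, which is automatic for cochains out of the bounded
complex `X`. The cone of `P ⟶ X` is acyclic and `J` is injective, so homotopies can be built upwards
from a degree below which all data vanish, without any bound on `J`. Hence the cohomology is
`Hom_K(X, J) = Hom_K(λ X, J)`; see `bijective_pairK_of_injective`.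

For part 2 take `V = P^∨`, `W = P^*` and `Y` in `K(Proj R)`. Since `P` is exact in low degrees,
`Hom(P^∨, A)` is exact in high degrees for `A` projective, so `Hom_K(P^∨, Y)` only depends on
degrees at most some `N`; these involve finitely many terms because `P^∨` is bounded below. Dually
one finds cochains `Y ⟶ P^*` vanishing in high degrees. They compute `Hom_K(Y, X^*) = Hom_K(Y,
ρ(X^*))`, because `X^* ⟶ P^*` is a quasi-isomorphism and `X^*` is bounded above; see
`bijective_pairK_of_projective`.

The duality is always given by a single linear form on `Hom(F X, N X)`, and its naturality is
dinaturality of that form. `SerreTrace` records this, and Yoneda produces the partial Serre functor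
on the essential image of `F`. -/

namespace CochainComplex

open CochainComplex.HomComplex Limits Preadditive

/-! ### Constructing homotopies degree by degree, with control of supports -/

section Preadditive

variable {C : Type*} [Category* C] [Preadditive C]

/-- Exactness at `K.X m` of the complex `Hom(K, A)`. -/
def HomExactAt (K : CochainComplex C ℤ) (A : C) (m : ℤ) : Prop :=
  ∀ u : K.X m ⟶ A, K.d (m - 1) m ≫ u = 0 → ∃ v : K.X (m + 1) ⟶ A, K.d m (m + 1) ≫ v = u

/-- The defect of `δ α = f` in degree `n + 1` is killed by the incoming differential of `K`, because
`f` is a chain map and the equation holds in degree `n`. Exactness writes the defect as a composite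
with the outgoing differential; the correction lives in source degree `n + 2`, so degrees at most
`n` are untouched. -/
lemma exists_extension_of_homExactAt {K L : CochainComplex C ℤ}
    (f : K ⟶ L) (α : Cochain K L (-1)) (n m : ℤ) (hnm : n + 1 = m)
    (hK : HomExactAt K (L.X m) m)
    (hα : (δ (-1) 0 α).EqUpTo (Cochain.ofHom f) n) :
    ∃ (h : K.X (n + 2) ⟶ L.X (n + 1)),
      (δ (-1) 0 (α + Cochain.single h (-1))).EqUpTo (Cochain.ofHom f) m := by
  subst hnm
  let u := f.f (n + 1) - α.v (n + 1) n (by lia) ≫ L.d n (n + 1) -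
    K.d (n + 1) (n + 2) ≫ α.v (n + 2) (n + 1) (by lia)
  have hu : K.d n (n + 1) ≫ u = 0 := by
    have eq := hα n n (add_zero n) (by rfl)
    simp only [δ_v (-1) 0 (neg_add_cancel 1) α n n (add_zero _) (n - 1) (n + 1)
      (by lia) (by lia), Int.negOnePow_zero, one_smul, Cochain.ofHom_v] at eq
    simp only [u, comp_sub, HomologicalComplex.d_comp_d_assoc, zero_comp,
      ← f.comm, ← eq, add_comp, Category.assoc, L.d_comp_d, comp_zero, zero_add, sub_self]
  obtain ⟨β, hβ⟩ : ∃ (β : K.X (n + 2) ⟶ L.X (n + 1)), K.d (n + 1) (n + 2) ≫ β = u := by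
    have h1 : n + 1 - 1 = n := by lia
    have h2 : n + 1 + 1 = n + 2 := by lia
    unfold HomExactAt at hK
    rw [h1, h2] at hK
    exact hK u hu
  refine ⟨β, ?_⟩
  intro p q hpq hp
  obtain rfl : p = q := by lia
  obtain hp | rfl := hp.lt_or_eq
  · rw [δ_add, Cochain.add_v, hα p p (by lia) (by lia), add_eq_left,
      δ_v (-1) 0 (neg_add_cancel 1) _ p p hpq (p - 1) (p + 1) rfl rfl,
      Cochain.single_v_eq_zero _ _ _ _ _ (by lia),
      Cochain.single_v_eq_zero _ _ _ _ _ (by lia)]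
    simp
  · rw [δ_v (-1) 0 (neg_add_cancel 1) _ (n + 1) (n + 1) (by lia) n (n + 2)
      (by lia) (by lia), Cochain.add_v,
      Cochain.single_v_eq_zero _ _ _ _ _ (by lia)]
    simp [hβ, u]

open Cochain.InductionUp in
/-- A morphism `K ⟶ L` that vanishes below degree `d` is the coboundary of a cochain that
vanishes up to degree `d`, if `Hom(K, L.X m)` is exact in all degrees `m ≥ d`. -/
lemma exists_δ_eq_ofHom {K L : CochainComplex C ℤ} (f : K ⟶ L) (d : ℤ)
    (hf : ∀ p < d, f.f p = 0) (hK : ∀ m, d ≤ m → HomExactAt K (L.X m) m) :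
    ∃ α : Cochain K L (-1), δ (-1) 0 α = Cochain.ofHom f ∧
      ∀ p q hpq, p ≤ d → α.v p q hpq = 0 := by
  -- Stage `n` solves the equation up to degree `n + d - 1`; with this offset the zero cochain is a
  -- solution at stage `0`.
  let X (n : ℕ) : Set (Cochain K L (-1)) :=
    Set.ofPred (fun α => (δ (-1) 0 α).EqUpTo (Cochain.ofHom f) (n + d - 1))
  let x₀ : X 0 := ⟨0, fun p q hpq hp ↦ by
    obtain rfl : p = q := by lia
    rw [δ_zero, Cochain.zero_v, Cochain.ofHom_v, hf p (by push_cast at hp; lia)]⟩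
  let φ (n : ℕ) (α : X n) : X (n + 1) :=
    ⟨_, (exists_extension_of_homExactAt f α.1 (n + d - 1) ((n + 1 : ℕ) + d - 1)
      (by lia) (hK _ (by lia)) α.2).choose_spec⟩
  have hφ (k : ℕ) (x : X k) : (φ k x).1.EqUpTo x.1 (d + k) := fun p q hpq hp => by
    dsimp [φ]
    rw [add_eq_left, Cochain.single_v_eq_zero _ _ _ _ _ (by lia)]
  refine ⟨limitSequence φ hφ x₀, ?_, fun p q hpq hp ↦ ?_⟩
  · ext n
    -- From this stage on, the equation holds in degree `n`, and the components of source degrees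
    -- `n` and `n + 1` that enter it no longer change.
    let k₀ := (n - d + 1).toNat
    rw [← (sequence φ x₀ k₀).2 n n (add_zero n) (by lia),
      δ_v (-1) 0 (neg_add_cancel 1) _ n n (by lia) (n - 1) (n + 1) rfl (by lia),
      δ_v (-1) 0 (neg_add_cancel 1) _ n n (by lia) (n - 1) (n + 1) rfl (by lia),
      limitSequence_eqUpTo φ hφ x₀ k₀ n (n - 1) (by lia) (by lia),
      limitSequence_eqUpTo φ hφ x₀ k₀ (n + 1) n (by lia) (by lia)]
  · rw [limitSequence_eqUpTo φ hφ x₀ 0 p q hpq (by simpa using hp)]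
    rfl

/-- If `L⟦n⟧` has the property that morphisms `f : K ⟶ L⟦n⟧` are coboundaries of
cochains, compatibly with supports, then cocycles of degree `n` are coboundaries. -/
lemma exists_δ_eq_of_shift {K L : CochainComplex C ℤ} {n m : ℤ} (hm : m + 1 = n)
    (z : Cocycle K L n) (P : ℤ → Prop)
    (H : ∀ f : K ⟶ L⟦n⟧, (∀ p q hpq, z.1.v p q hpq = 0 → f.f p = 0) →
      ∃ α : Cochain K (L⟦n⟧) (-1), δ (-1) 0 α = Cochain.ofHom f ∧
        ∀ p q hpq, P p → α.v p q hpq = 0) :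
    ∃ α : Cochain K L m, δ m n α = z.1 ∧ ∀ p q hpq, P p → α.v p q hpq = 0 := by
  obtain ⟨f, hf⟩ := (Cocycle.equivHom ..).surjective (z.rightShift n 0 (zero_add n))
  rw [Cocycle.ext_iff] at hf
  have hf' : Cochain.ofHom f = z.1.rightShift n 0 (zero_add n) := hf
  obtain ⟨α, hα, hα0⟩ := H f (fun p q hpq h0 ↦ by
    rw [← Cochain.ofHom_v, hf', Cochain.rightShift_v _ _ _ _ _ _ _ _ hpq, h0, zero_comp])
  -- Unshifting by `n` commutes with `δ` only up to `(-1)^n`, which the sign compensates.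
  refine ⟨n.negOnePow • α.rightUnshift m (by omega), ?_, fun p q hpq hp ↦ ?_⟩
  · apply (Cochain.rightShiftAddEquiv _ _ _ n 0 (by simp)).injective
    change (δ m n (n.negOnePow • α.rightUnshift m (by omega))).rightShift n 0 (by omega) =
      z.1.rightShift n 0 (by omega)
    rw [← hf', δ_units_smul, Cochain.rightShift_units_smul,
      Cochain.δ_rightUnshift _ _ _ _ 0 (by simp), hα]
    simp [smul_smul]
  · rw [Cochain.units_smul_v, Cochain.rightUnshift_v _ _ _ _ _ _ (p + (-1)) rfl,
      hα0 _ _ _ hp, zero_comp, smul_zero]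

/-- A cocycle that vanishes below degree `d` is the coboundary of a cochain that
vanishes up to degree `d`, if `Hom(K, L.X j)` is exact in all degrees `m ≥ d`. -/
lemma exists_δ_eq_of_homExactAt {K L : CochainComplex C ℤ} {n m : ℤ} (hm : m + 1 = n)
    (z : Cocycle K L n) (d : ℤ) (hz : ∀ p q hpq, p < d → z.1.v p q hpq = 0)
    (hK : ∀ m j, d ≤ m → HomExactAt K (L.X j) m) :
    ∃ α : Cochain K L m, δ m n α = z.1 ∧ ∀ p q hpq, p ≤ d → α.v p q hpq = 0 :=
  exists_δ_eq_of_shift hm z (· ≤ d) fun f hf ↦ exists_δ_eq_ofHom f d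
    (fun p hp ↦ hf p _ rfl (hz p _ rfl hp)) fun m hm ↦ hK m _ hm

end Preadditive

section Abelian

variable {C : Type*} [Category* C] [Abelian C]

lemma acyclic_shift {K : CochainComplex C ℤ} (hK : K.Acyclic) (n : ℤ) : (K⟦n⟧).Acyclic := by
  rw [← HomotopyCategory.quotient_obj_mem_subcategoryAcyclic_iff_acyclic] at hK ⊢
  exact ObjectProperty.prop_of_iso _
    (((HomotopyCategory.quotient C (.up ℤ)).commShiftIso n).symm.app K)
    ((HomotopyCategory.subcategoryAcyclic C).le_shift n _ hK)

lemma Acyclic.homExactAt {K : CochainComplex C ℤ} (hK : K.Acyclic) (A : C) [Injective A] (m : ℤ) :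
    HomExactAt K A m := by
  intro u hu
  have h := hK m
  rw [K.exactAt_iff' (m - 1) m (m + 1) (by simp) (by simp)] at h
  exact ⟨h.descToInjective _ hu, h.comp_descToInjective _ _⟩

/-- A morphism from a complex of projectives to an acyclic complex that vanishes above degree `d`
is the coboundary of a cochain which vanishes above degree `d`. -/
lemma exists_δ_eq_ofHom_of_projective {K L : CochainComplex C ℤ} (hL : L.Acyclic)
    [∀ n, Projective (K.X n)] (f : K ⟶ L) (d : ℤ) (hf : ∀ p, d < p → f.f p = 0) :
    ∃ α : Cochain K L (-1), δ (-1) 0 α = Cochain.ofHom f ∧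
      ∀ p q hpq, d < p → α.v p q hpq = 0 := by
  -- In the opposite category projectives become injectives and degrees change sign, so the upward
  -- induction applies with bound `-d`.
  let K' := (opEquivalence C).functor.obj (op K)
  let L' := (opEquivalence C).functor.obj (op L)
  have (n : ℤ) : Injective (K'.X n) :=
    inferInstanceAs (Injective (op (K.X (-n))))
  obtain ⟨α, hα, hα0⟩ := exists_δ_eq_ofHom ((opEquivalence C).functor.map f.op) (-d)
    (fun p hp ↦ by
      change (f.f (-p)).op = 0
      rw [hf _ (by omega), op_zero])
    (fun m _ ↦ Acyclic.homExactAt (acyclic_op hL) (K'.X m) m)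
  let h : Homotopy ((opEquivalence C).functor.map f.op)
      ((opEquivalence C).functor.map (0 : K ⟶ L).op) :=
    (Cochain.equivHomotopy _ _).symm ⟨α, by simp [hα]⟩
  refine ⟨Cochain.ofHomotopy (homotopyUnop h), by simp [δ_ofHomotopy], fun p q hpq hp ↦ ?_⟩
  -- Here `q = p - 1`, so on the opposite side the component starts in degree `-q = -p + 1`, which
  -- is at most `-d` exactly when `d < p`.
  have h0 : h.hom (-q) (-p) = 0 := by
    have e : -q + -1 = -p := by omega
    have : h.hom (-q) (-p) = α.v (-q) (-p) e := dif_pos e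
    rw [this, hα0 _ _ e (by omega)]
  change (homotopyUnop h).hom p q = 0
  rw [homotopyUnop_hom_eq h p q (-p) (-q) (by omega) (by omega), h0]
  exact (congrArg _ zero_comp).trans comp_zero

/-- A cocycle from a complex of projectives to an acyclic complex that vanishes above degree `d`
is the coboundary of a cochain which vanishes above degree `d`. -/
lemma exists_δ_eq_of_projective {K L : CochainComplex C ℤ} (hL : L.Acyclic)
    [∀ n, Projective (K.X n)] {n m : ℤ} (hm : m + 1 = n)
    (z : Cocycle K L n) (d : ℤ) (hz : ∀ p q hpq, d < p → z.1.v p q hpq = 0) :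
    ∃ α : Cochain K L m, δ m n α = z.1 ∧ ∀ p q hpq, d < p → α.v p q hpq = 0 :=
  exists_δ_eq_of_shift hm z (d < ·) fun f hf ↦ exists_δ_eq_ofHom_of_projective
    (acyclic_shift hL n) f d
    (fun p hp ↦ hf p _ rfl (hz p _ rfl hp))

end Abelian

end CochainComplex

/-! ### Extending and lifting along quasi-isomorphisms -/

namespace CochainComplex

open CochainComplex.HomComplex Limits Preadditive

section Abelian

variable {C : Type*} [Category* C] [Abelian C]

lemma acyclic_mappingCone {K L : CochainComplex C ℤ} (f : K ⟶ L) [QuasiIso f] :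
    (mappingCone f).Acyclic := by
  have h : HomotopyCategory.quasiIso C (ComplexShape.up ℤ)
      ((HomotopyCategory.quotient C (ComplexShape.up ℤ)).map f) := by
    rw [HomotopyCategory.quotient_map_mem_quasiIso_iff]
    assumption
  rw [HomotopyCategory.quasiIso_eq_trW_subcategoryAcyclic] at h
  obtain ⟨Z, a, b, hT, hZ⟩ := h
  rw [← HomotopyCategory.quotient_obj_mem_subcategoryAcyclic_iff_acyclic]
  exact ObjectProperty.prop_of_iso _ (Pretriangulated.Triangle.π₃.mapIso
    (Pretriangulated.isoTriangleOfIso₁₂ _ _ hT (HomotopyCategory.mappingCone_triangleh_distinguished f)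
      (Iso.refl _) (Iso.refl _) ((Category.comp_id _).trans (Category.id_comp _).symm))) hZ

/-- Morphisms to a complex of injectives extend along quasi-isomorphisms, up to homotopy,
if they vanish in low degrees. -/
lemma exists_comp_add_δ_of_injective {K L J : CochainComplex C ℤ} (f : K ⟶ L) [QuasiIso f]
    [∀ n, Injective (J.X n)] (z : K ⟶ J) (d : ℤ) (hz : ∀ p < d, z.f p = 0) :
    ∃ (a : L ⟶ J) (w : Cochain K J (-1)), Cochain.ofHom z = Cochain.ofHom (f ≫ a) + δ (-1) 0 w ∧
      ∀ p q hpq, p < d → w.v p q hpq = 0 := by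
  -- A primitive of this cocycle on the acyclic cone contains both outputs: along `inr` it gives the
  -- extension up to sign, along `inl` the homotopy.
  let z' : Cocycle (mappingCone f) J 1 :=
    Cocycle.mk ((mappingCone.fst f).1.comp (Cochain.ofHom z) (add_zero 1)) 2 (by norm_num)
      (by simp)
  -- The bound drops by one because the cone in degree `p` contains `K` in degree `p + 1`.
  obtain ⟨α, hα, hα0⟩ := exists_δ_eq_of_homExactAt (zero_add 1) z' (d - 1)
    (fun p q hpq hp ↦ by
      change ((mappingCone.fst f).1.comp (Cochain.ofHom z) (add_zero 1)).v p q hpq = 0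
      rw [Cochain.comp_zero_cochain_v, Cochain.ofHom_v, hz q (by omega), comp_zero])
    (fun m j _ ↦ Acyclic.homExactAt (acyclic_mappingCone f) _ m)
  replace hα : δ 0 1 α = (mappingCone.fst f).1.comp (Cochain.ofHom z) (add_zero 1) := hα
  let a : Cocycle L J 0 := Cocycle.mk ((Cochain.ofHom (mappingCone.inr f)).comp α (zero_add 0)) 1
    (zero_add 1) (by
      rw [δ_ofHom_comp, hα, mappingCone.inr_fst_assoc])
  refine ⟨-a.homOf, (mappingCone.inl f).comp α (add_zero _), ?_, fun p q hpq hp ↦ ?_⟩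
  · rw [δ_comp _ α (add_zero (-1)) 0 1 0 (by simp) (by simp) (by simp), hα,
      mappingCone.inl_fst_assoc, mappingCone.δ_inl]
    simp [a]
  · rw [Cochain.comp_zero_cochain_v, hα0 _ _ _ (by omega), comp_zero]

/-- Morphisms to a complex of injectives which are null-homotopic after composition with a
quasi-isomorphism are null-homotopic if the data vanish in low degrees. -/
lemma exists_δ_eq_of_injective {K L J : CochainComplex C ℤ} (f : K ⟶ L) [QuasiIso f]
    [∀ n, Injective (J.X n)] (a : L ⟶ J) (w : Cochain K J (-1))
    (h : δ (-1) 0 w = Cochain.ofHom (f ≫ a)) (d : ℤ) (ha : ∀ p < d, a.f p = 0)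
    (hw : ∀ p q hpq, p ≤ d → w.v p q hpq = 0) :
    ∃ α : Cochain L J (-1), δ (-1) 0 α = Cochain.ofHom a ∧
      ∀ p q hpq, p ≤ d → α.v p q hpq = 0 := by
  -- The null-homotopy and `a` glue to a chain map on the acyclic cone. On its `K`-part in degree
  -- `p` this is `w` in degree `p + 1`, hence the non-strict bound on `w`.
  obtain ⟨α, hα, hα0⟩ := exists_δ_eq_ofHom (mappingCone.desc f w a h) d
    (fun p hp ↦ by
      rw [mappingCone.desc_f f w a h p (p + 1) rfl, ha p hp, hw _ _ _ (by omega), comp_zero,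
        comp_zero, add_zero])
    (fun m _ ↦ Acyclic.homExactAt (acyclic_mappingCone f) _ m)
  refine ⟨(Cochain.ofHom (mappingCone.inr f)).comp α (zero_add _), ?_, fun p q hpq hp ↦ ?_⟩
  · rw [δ_ofHom_comp, hα, ← Cochain.ofHom_comp, mappingCone.inr_desc]
  · rw [Cochain.zero_cochain_comp_v, hα0 _ _ _ (by omega), comp_zero]

/-- Morphisms from a complex of projectives lift along quasi-isomorphisms, up to homotopy,
if they vanish in high degrees. -/
lemma exists_comp_add_δ_of_projective {K L Q : CochainComplex C ℤ} (f : K ⟶ L) [QuasiIso f]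
    [∀ n, Projective (Q.X n)] (z : Q ⟶ L) (d : ℤ) (hz : ∀ p, d < p → z.f p = 0) :
    ∃ (a : Q ⟶ K) (w : Cochain Q L (-1)), Cochain.ofHom z = Cochain.ofHom (a ≫ f) + δ (-1) 0 w ∧
      ∀ p q hpq, d < p → w.v p q hpq = 0 := by
  obtain ⟨α, hα, hα0⟩ := exists_δ_eq_ofHom_of_projective (acyclic_mappingCone f)
    (z ≫ mappingCone.inr f) d (fun p hp ↦ by simp [hz p hp])
  let a : Cocycle Q K 0 := Cocycle.mk (α.comp (mappingCone.fst f).1 (neg_add_cancel 1)) 1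
    (zero_add 1) (by
      rw [δ_comp _ _ (neg_add_cancel 1) 0 2 1 (by simp) (by simp) (by norm_num), hα]
      simp)
  refine ⟨a.homOf, α.comp (mappingCone.snd f) (add_zero _), ?_, fun p q hpq hp ↦ ?_⟩
  · rw [δ_comp_zero_cochain _ _ 0 (by simp), hα, mappingCone.δ_snd]
    simp [a]
  · rw [Cochain.comp_zero_cochain_v, hα0 _ _ _ (by omega), zero_comp]

/-- Morphisms from a complex of projectives which are null-homotopic after composition with a
quasi-isomorphism are null-homotopic if the data vanish in high degrees. -/
lemma exists_δ_eq_of_projective_comp {K L Q : CochainComplex C ℤ} (f : K ⟶ L) [QuasiIso f]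
    [∀ n, Projective (Q.X n)] (a : Q ⟶ K) (w : Cochain Q L (-1))
    (h : δ (-1) 0 w = Cochain.ofHom (a ≫ f)) (d : ℤ) (ha : ∀ p, d < p → a.f p = 0)
    (hw : ∀ p q hpq, d < p → w.v p q hpq = 0) :
    ∃ α : Cochain Q K (-1), δ (-1) 0 α = Cochain.ofHom a ∧
      ∀ p q hpq, d < p → α.v p q hpq = 0 := by
  -- The pair `(a, -w)` is a cocycle into the acyclic cone; the `K`-component of a primitive is, up
  -- to sign, the desired null-homotopy of `a`.
  let z : Cocycle Q (mappingCone f) (-1) :=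
    mappingCone.liftCocycle f (Cocycle.ofHom a) (-w) (neg_add_cancel 1) (by simp [h])
  obtain ⟨α, hα, hα0⟩ := exists_δ_eq_of_projective (acyclic_mappingCone f)
    (show -2 + 1 = -1 by norm_num) z d (fun p q hpq hp ↦ by
      have h1 : a.f p = 0 := ha p hp
      have h2 := hw p q hpq hp
      change (mappingCone.liftCochain f (Cochain.ofHom a) (-w) (neg_add_cancel 1)).v p q hpq = 0
      rw [mappingCone.liftCochain, Cochain.add_v, Cochain.zero_cochain_comp_v,
        Cochain.comp_zero_cochain_v]
      simp [h1, h2])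
  refine ⟨-α.comp (mappingCone.fst f).1 (by norm_num), ?_, fun p q hpq hp ↦ ?_⟩
  · rw [δ_neg, δ_comp _ _ (show -2 + 1 = -1 by norm_num) (-1) 2 0 (by simp) (by simp) (by norm_num),
      hα]
    simp [z]
  · rw [Cochain.neg_v, Cochain.comp_v _ _ _ p (p + (-2)) q rfl (by omega), hα0 _ _ _ hp, zero_comp,
      neg_zero]

lemma quasiIso_opEquivalence_map_iff {K L : CochainComplex C ℤ} (f : K ⟶ L) :
    QuasiIso ((opEquivalence C).functor.map f.op) ↔ QuasiIso f := by
  have key (n m : ℤ) (h : m = -n) :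
      QuasiIsoAt ((opEquivalence C).functor.map f.op) n ↔ QuasiIsoAt f m := by
    subst h
    rw [quasiIsoAt_iff' _ (n - 1) n (n + 1) (by simp) (by simp),
      quasiIsoAt_iff' f (-(n + 1)) (-n) (-(n - 1)) (by simp; omega) (by simp; omega)]
    exact ShortComplex.quasiIso_opMap_iff
      ((HomologicalComplex.shortComplexFunctor' C (ComplexShape.up ℤ) (-(n + 1)) (-n)
        (-(n - 1))).map f)
  simp only [quasiIso_iff]
  exact ⟨fun h n ↦ (key (-n) n (by omega)).1 (h _), fun h n ↦ (key n (-n) rfl).2 (h _)⟩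

/-- A complex which is bounded above admits a quasi-isomorphism from a complex of projectives
which is bounded above. -/
lemma exists_quasiIso_projective [EnoughProjectives C] (K : CochainComplex C ℤ) (n : ℤ)
    [K.IsStrictlyLE n] :
    ∃ (P : CochainComplex C ℤ) (f : P ⟶ K), QuasiIso f ∧ (∀ i, Projective (P.X i)) ∧
      P.IsStrictlyLE n := by
  let K' := (opEquivalence C).functor.obj (op K)
  have : K'.IsStrictlyGE (-n) := by
    rw [isStrictlyGE_iff]
    exact fun i hi ↦ (K.isZero_of_isStrictlyLE n (-i) (by omega)).op
  obtain ⟨L, i, hi, hL, hL'⟩ := Plus.modelCategoryQuillen.exists_quasiIso_injective K' (-n)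
  let P := ((opEquivalence C).inverse.obj L).unop
  let e : L ≅ (opEquivalence C).functor.obj (op P) := ((opEquivalence C).counitIso.app L).symm
  obtain ⟨g, hg⟩ := (opEquivalence C).functor.map_surjective (i ≫ e.hom)
  let e' (m : ℤ) : op (P.X m) ≅ L.X (-m) :=
    Iso.op (P.XIsoOfEq (show - -m = m by omega)) ≪≫
      ((HomologicalComplex.eval _ _ (-m)).mapIso e).symm
  refine ⟨P, g.unop, ?_, fun m ↦ ?_, ?_⟩
  · rw [← quasiIso_opEquivalence_map_iff]
    change QuasiIso ((opEquivalence C).functor.map g)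
    rw [hg]
    infer_instance
  · have : Injective (op (P.X m)) := Injective.of_iso (e' m).symm (hL _)
    exact inferInstanceAs (Projective (unop (op (P.X m))))
  · rw [isStrictlyLE_iff]
    exact fun m hm ↦ ((L.isZero_of_isStrictlyGE (-n) (-m) (by omega)).of_iso (e' m)).unop

end Abelian

end CochainComplex

/-! ### Universal arrows of partial adjoints -/

namespace CategoryTheory.Functor

section

variable {C D : Type*} [Category* C] [Category* D] (F : C ⥤ D)

/-- The counit of the partial right adjoint. -/
noncomputable def partialRightAdjointCounit (Y : F.PartialRightAdjointSource) :
    F.obj (F.partialRightAdjointObj Y) ⟶ Y.obj :=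
  F.partialRightAdjointHomEquiv (𝟙 _)

lemma partialRightAdjointHomEquiv_eq {X : C} {Y : F.PartialRightAdjointSource}
    (f : X ⟶ F.partialRightAdjointObj Y) :
    F.partialRightAdjointHomEquiv f = F.map f ≫ F.partialRightAdjointCounit Y := by
  rw [partialRightAdjointCounit, ← partialRightAdjointHomEquiv_comp, Category.comp_id]

lemma map_partialRightAdjointMap_counit {Y Y' : F.PartialRightAdjointSource} (f : Y ⟶ Y') :
    F.map (F.partialRightAdjointMap f) ≫ F.partialRightAdjointCounit Y' =
      F.partialRightAdjointCounit Y ≫ f.hom := by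
  rw [← partialRightAdjointHomEquiv_eq, partialRightAdjointHomEquiv_map]
  rfl

lemma bijective_comp_partialRightAdjointCounit (X : C) (Y : F.PartialRightAdjointSource) :
    Function.Bijective (fun f : X ⟶ F.partialRightAdjointObj Y ↦
      F.map f ≫ F.partialRightAdjointCounit Y) := by
  simpa only [← partialRightAdjointHomEquiv_eq] using!
    (F.partialRightAdjointHomEquiv (X := X) (Y := Y)).bijective

lemma rightAdjointObjIsDefined_of_bijective {Y : D} (X : C) (ε : F.obj X ⟶ Y)
    (h : ∀ X', Function.Bijective (fun f : X' ⟶ X ↦ F.map f ≫ ε)) :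
    F.rightAdjointObjIsDefined Y :=
  RepresentableBy.isRepresentable (F := F.op ⋙ yoneda.obj Y) (Y := X)
    { homEquiv := fun {X'} ↦ Equiv.ofBijective _ (h X')
      homEquiv_comp := fun f g ↦ by
        change F.map (f ≫ g) ≫ ε = F.map f ≫ (F.map g ≫ ε)
        rw [F.map_comp, Category.assoc] }

/-- An object with the universal property of the partial right adjoint is isomorphic to it,
compatibly with the counits. -/
lemma exists_iso_partialRightAdjointObj (Y : F.PartialRightAdjointSource) (X : C)
    (ε : F.obj X ⟶ Y.obj) (h : ∀ X', Function.Bijective (fun f : X' ⟶ X ↦ F.map f ≫ ε)) :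
    ∃ e : F.partialRightAdjointObj Y ≅ X, F.map e.hom ≫ ε = F.partialRightAdjointCounit Y := by
  obtain ⟨a, ha⟩ := (h _).surjective (F.partialRightAdjointCounit Y)
  obtain ⟨b, hb⟩ := (F.bijective_comp_partialRightAdjointCounit X Y).surjective ε
  dsimp only at ha hb
  refine ⟨⟨a, b, (F.bijective_comp_partialRightAdjointCounit _ Y).injective ?_,
    (h _).injective ?_⟩, ha⟩
  · simp [hb, ha]
  · simp [hb, ha]

/-- The unit of the partial left adjoint. -/
noncomputable def partialLeftAdjointUnit (X : F.PartialLeftAdjointSource) :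
    X.obj ⟶ F.obj (F.partialLeftAdjointObj X) :=
  F.partialLeftAdjointHomEquiv (𝟙 _)

lemma partialLeftAdjointHomEquiv_eq {X : F.PartialLeftAdjointSource} {Y : C}
    (f : F.partialLeftAdjointObj X ⟶ Y) :
    F.partialLeftAdjointHomEquiv f = F.partialLeftAdjointUnit X ≫ F.map f := by
  rw [partialLeftAdjointUnit, ← partialLeftAdjointHomEquiv_comp, Category.id_comp]

lemma partialLeftAdjointUnit_map {X X' : F.PartialLeftAdjointSource} (f : X ⟶ X') :
    F.partialLeftAdjointUnit X ≫ F.map (F.partialLeftAdjointMap f) =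
      f.hom ≫ F.partialLeftAdjointUnit X' := by
  rw [← partialLeftAdjointHomEquiv_eq, partialLeftAdjointHomEquiv_map]
  rfl

lemma bijective_partialLeftAdjointUnit_comp (X : F.PartialLeftAdjointSource) (Y : C) :
    Function.Bijective (fun f : F.partialLeftAdjointObj X ⟶ Y ↦
      F.partialLeftAdjointUnit X ≫ F.map f) := by
  simpa only [← partialLeftAdjointHomEquiv_eq] using!
    (F.partialLeftAdjointHomEquiv (X := X) (Y := Y)).bijective

lemma leftAdjointObjIsDefined_of_bijective {X : D} (Y : C) (η : X ⟶ F.obj Y)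
    (h : ∀ Y', Function.Bijective (fun f : Y ⟶ Y' ↦ η ≫ F.map f)) :
    F.leftAdjointObjIsDefined X :=
  CorepresentableBy.isCorepresentable (F := F ⋙ coyoneda.obj (op X)) (X := Y)
    { homEquiv := fun {Y'} ↦ Equiv.ofBijective _ (h Y')
      homEquiv_comp := fun g f ↦ by
        change η ≫ F.map (f ≫ g) = (η ≫ F.map f) ≫ F.map g
        rw [F.map_comp, Category.assoc] }

end

end CategoryTheory.Functor

/-! ### Quasi-isomorphisms and homotopy classes of morphisms -/

namespace CochainComplex

open CochainComplex.HomComplex Limits Preadditive HomotopyCategory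

section Preadditive

variable {C : Type*} [Category* C] [Preadditive C]

lemma quotient_map_eq_zero_of_δ {K L : CochainComplex C ℤ} {f : K ⟶ L} {α : Cochain K L (-1)}
    (h : δ (-1) 0 α = Cochain.ofHom f) :
    (quotient C (ComplexShape.up ℤ)).map f = 0 := by
  rw [eq_of_homotopy f 0 ((Cochain.equivHomotopy f 0).symm ⟨α, by simp [h]⟩), Functor.map_zero]

lemma quotient_map_eq_of_δ {K L : CochainComplex C ℤ} {f g : K ⟶ L} {α : Cochain K L (-1)}
    (h : Cochain.ofHom f = Cochain.ofHom g + δ (-1) 0 α) :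
    (quotient C (ComplexShape.up ℤ)).map f = (quotient C (ComplexShape.up ℤ)).map g :=
  eq_of_homotopy f g ((Cochain.equivHomotopy f g).symm ⟨α, by rw [h, add_comm]⟩)

lemma exists_δ_eq_of_quotient_map_eq {K L : CochainComplex C ℤ} {f g : K ⟶ L}
    (h : (quotient C (ComplexShape.up ℤ)).map f = (quotient C (ComplexShape.up ℤ)).map g) :
    ∃ α : Cochain K L (-1), Cochain.ofHom f = Cochain.ofHom g + δ (-1) 0 α :=
  let α := Cochain.equivHomotopy f g (homotopyOfEq f g h)
  ⟨α.1, α.2.trans (add_comm _ _)⟩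

end Preadditive

section Abelian

variable {C : Type*} [Category* C] [Abelian C]

/-- Precomposition with a quasi-isomorphism between bounded below complexes is bijective on
homotopy classes of morphisms to a complex of injectives. -/
lemma bijective_quotient_map_comp_of_injective {K L J : CochainComplex C ℤ} (f : K ⟶ L)
    [QuasiIso f] [∀ n, Injective (J.X n)] (d : ℤ) [K.IsStrictlyGE d] [L.IsStrictlyGE d] :
    Function.Bijective (fun a : (quotient C (ComplexShape.up ℤ)).obj L ⟶ (quotient C _).obj J ↦
      (quotient C _).map f ≫ a) := by
  have hK (p : ℤ) (hp : p < d) : IsZero (K.X p) := K.isZero_of_isStrictlyGE d p hp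
  have hL (p : ℤ) (hp : p < d) : IsZero (L.X p) := L.isZero_of_isStrictlyGE d p hp
  constructor
  · intro a b hab
    obtain ⟨a, rfl⟩ := (quotient _ _).map_surjective a
    obtain ⟨b, rfl⟩ := (quotient _ _).map_surjective b
    dsimp only at hab
    rw [← Functor.map_comp, ← Functor.map_comp] at hab
    obtain ⟨w, hw⟩ := exists_δ_eq_of_quotient_map_eq hab
    obtain ⟨α, hα, -⟩ := exists_δ_eq_of_injective f (a - b) w
      (by rw [comp_sub, Cochain.ofHom_sub, hw]; abel) (d - 1)
      (fun p hp ↦ (hL p (by omega)).eq_of_src _ _) (fun p q _ hp ↦ (hK p (by omega)).eq_of_src _ _)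
    rw [← sub_eq_zero, ← Functor.map_sub, quotient_map_eq_zero_of_δ hα]
  · intro z
    obtain ⟨z, rfl⟩ := (quotient _ _).map_surjective z
    obtain ⟨a, w, h, -⟩ := exists_comp_add_δ_of_injective f z d
      (fun p hp ↦ (hK p (by omega)).eq_of_src _ _)
    refine ⟨(quotient _ _).map a, ?_⟩
    dsimp only
    rw [← Functor.map_comp, quotient_map_eq_of_δ h]

/-- Composition with a quasi-isomorphism between bounded above complexes is bijective on
homotopy classes of morphisms from a complex of projectives. -/
lemma bijective_comp_quotient_map_of_projective {K L Q : CochainComplex C ℤ} (f : K ⟶ L)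
    [QuasiIso f] [∀ n, Projective (Q.X n)] (d : ℤ) [K.IsStrictlyLE d] [L.IsStrictlyLE d] :
    Function.Bijective (fun a : (quotient C (ComplexShape.up ℤ)).obj Q ⟶ (quotient C _).obj K ↦
      a ≫ (quotient C _).map f) := by
  have hK (p : ℤ) (hp : d < p) : IsZero (K.X p) := K.isZero_of_isStrictlyLE d p hp
  have hL (p : ℤ) (hp : d < p) : IsZero (L.X p) := L.isZero_of_isStrictlyLE d p hp
  constructor
  · intro a b hab
    obtain ⟨a, rfl⟩ := (quotient _ _).map_surjective a
    obtain ⟨b, rfl⟩ := (quotient _ _).map_surjective b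
    dsimp only at hab
    rw [← Functor.map_comp, ← Functor.map_comp] at hab
    obtain ⟨w, hw⟩ := exists_δ_eq_of_quotient_map_eq hab
    obtain ⟨α, hα, -⟩ := exists_δ_eq_of_projective_comp f (a - b) w
      (by rw [sub_comp, Cochain.ofHom_sub, hw]; abel) (d + 1)
      (fun p hp ↦ (hK p (by omega)).eq_of_tgt _ _) (fun p q _ hp ↦ (hL q (by omega)).eq_of_tgt _ _)
    rw [← sub_eq_zero, ← Functor.map_sub, quotient_map_eq_zero_of_δ hα]
  · intro z
    obtain ⟨z, rfl⟩ := (quotient _ _).map_surjective z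
    obtain ⟨a, w, h, -⟩ := exists_comp_add_δ_of_projective f z d
      (fun p hp ↦ (hL p (by omega)).eq_of_tgt _ _)
    refine ⟨(quotient _ _).map a, ?_⟩
    dsimp only
    rw [← Functor.map_comp, quotient_map_eq_of_δ h]

end Abelian

end CochainComplex

/-! ### Existence of `λ` and `ρ` on bounded complexes -/

namespace PartialSerre

open CochainComplex Limits HomotopyCategory

variable {R : Type u} [Ring R]

/-- Makes `P` a model of `ρ X` with counit `f`. This serves both for the existence of `ρ X` and for
replacing `ρ X` by a resolution with finitely generated terms. -/
lemma bijective_comp_of_quasiIso {P X : CochainComplex (ModuleCat.{u} R) ℤ} (f : P ⟶ X)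
    [QuasiIso f] (d : ℤ) [P.IsStrictlyLE d] [X.IsStrictlyLE d]
    (hP : KProj R ((quotient _ _).obj P)) (Q : (KProj R).FullSubcategory) :
    Function.Bijective (fun g : Q ⟶ ⟨_, hP⟩ ↦ (KProj R).ι.map g ≫ (quotient _ _).map f) := by
  have (n : ℤ) : Projective (Q.obj.as.X n) := Q.property n
  exact (bijective_comp_quotient_map_of_projective (Q := Q.obj.as) f d).comp
    (KProj R).fullyFaithfulι.homEquiv.bijective

lemma rhoDefined_of_isStrictlyLE (X : KMod R) (d : ℤ) (hX : IsStrictlyLE X.as d) :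
    RhoDefined R X := by
  obtain ⟨P, f, _, hP, _⟩ := exists_quasiIso_projective X.as d
  exact (KProj R).ι.rightAdjointObjIsDefined_of_bijective (Y := X)
    ⟨(quotient _ _).obj P, hP⟩ ((quotient _ _).map f) (bijective_comp_of_quasiIso f d hP)

lemma lamDefined_of_isStrictlyGE (X : KMod R) (d : ℤ) (hX : IsStrictlyGE X.as d) :
    LamDefined R X := by
  obtain ⟨J, f, _, hJ, _⟩ := Plus.modelCategoryQuillen.exists_quasiIso_injective X.as d
  refine (KInj R).ι.leftAdjointObjIsDefined_of_bijective (X := X)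
    ⟨(quotient _ _).obj J, hJ⟩ ((quotient _ _).map f) fun J' ↦ ?_
  have (n : ℤ) : Injective (J'.obj.as.X n) := J'.property n
  exact (bijective_quotient_map_comp_of_injective (J := J'.obj.as) f d).comp
    (KInj R).fullyFaithfulι.homEquiv.bijective

lemma kbfpr_le_rhoDefined : Kbfpr R ≤ RhoDefined R := by
  rintro X ⟨⟨a, b, _, hb⟩, -⟩
  exact rhoDefined_of_isStrictlyLE X b hb

lemma kbfpr_le_lamDefined : Kbfpr R ≤ LamDefined R := by
  rintro X ⟨⟨a, b, ha, _⟩, -⟩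
  exact lamDefined_of_isStrictlyGE X a ha

end PartialSerre

/-! ### From dinatural perfect pairings to partial Serre functors -/

namespace PartialSerre

section Trace

universe v₁ u₁ v₂

variable {k : Type w} [CommRing k] {I : ModuleCat.{v₂} k}
variable {T : Type u₁} [Category.{v₁} T] [Preadditive T] [Linear k T]

/-- The pairing `(X ⟶ Y) × (Y ⟶ S) → I` given by a linear form on `X ⟶ S`. -/
def pairing {X S : T} (t : (X ⟶ S) →ₗ[k] I) (Y : T) : (Y ⟶ S) →ₗ[k] ((X ⟶ Y) →ₗ[k] I) where
  toFun g := t ∘ₗ Linear.rightComp k X g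
  map_add' g g' := LinearMap.ext fun a ↦
    (congrArg t (Preadditive.comp_add _ _ _ a g g')).trans (map_add t _ _)
  map_smul' c g := LinearMap.ext fun a ↦
    (congrArg t (Linear.comp_smul _ _ _ a c g)).trans (map_smul t _ _)

@[simp]
lemma pairing_apply {X S : T} (t : (X ⟶ S) →ₗ[k] I) {Y : T} (g : Y ⟶ S) (a : X ⟶ Y) :
    pairing t Y g a = t (a ≫ g) := rfl

/-- The pairings given by a linear form on `X ⟶ S` are perfect, i.e. `S` represents
`Y ↦ Hom_k(Hom(X, Y), I)`. -/
def IsPerfect {X S : T} (t : (X ⟶ S) →ₗ[k] I) (Y : T) : Prop :=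
  Function.Bijective (pairing t Y)

lemma IsPerfect.exists_eq {X S Y : T} {t : (X ⟶ S) →ₗ[k] I} (h : IsPerfect t Y)
    (φ : (X ⟶ Y) →ₗ[k] I) : ∃ g : Y ⟶ S, ∀ a, t (a ≫ g) = φ a :=
  let ⟨g, hg⟩ := h.surjective φ
  ⟨g, fun a ↦ LinearMap.congr_fun hg a⟩

lemma IsPerfect.hom_ext {X S Y : T} {t : (X ⟶ S) →ₗ[k] I} (h : IsPerfect t Y) {g g' : Y ⟶ S}
    (H : ∀ a, t (a ≫ g) = t (a ≫ g')) : g = g' :=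
  h.injective (LinearMap.ext H)

variable {A : Type*} [Category* A]

/-- Linear forms on `F.obj X ⟶ N.obj X` which are dinatural in `X` and define perfect pairings. -/
structure SerreTrace (I : ModuleCat.{v₂} k) (F N : A ⥤ T) where
  /-- the linear form -/
  tr (X : A) : (F.obj X ⟶ N.obj X) →ₗ[k] I
  tr_comp_map {X X' : A} (f : X ⟶ X') (a : F.obj X' ⟶ N.obj X) :
    tr X' (a ≫ N.map f) = tr X (F.map f ≫ a)
  isPerfect (X : A) (Y : T) : IsPerfect (tr X) Y

namespace SerreTrace

variable {F N : A ⥤ T} (t : SerreTrace I F N)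

/-- The linear form on `Z ⟶ N.obj X`, for a chosen isomorphism between `F.obj X` and an object `Z`
of the essential image of `F`. -/
noncomputable def trEssImage (Z : F.EssImageSubcategory) :
    (Z.obj ⟶ N.obj Z.property.witness) →ₗ[k] I :=
  t.tr _ ∘ₗ Linear.leftComp k _ Z.property.getIso.hom

lemma isPerfect_trEssImage (Z : F.EssImageSubcategory) (Y : T) :
    IsPerfect (t.trEssImage Z) Y := by
  constructor
  · intro g g' h
    refine (t.isPerfect _ Y).hom_ext fun a ↦ ?_
    have := LinearMap.congr_fun h (Z.property.getIso.inv ≫ a)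
    simpa [trEssImage] using this
  · intro φ
    obtain ⟨g, hg⟩ := (t.isPerfect Z.property.witness Y).exists_eq
      (φ ∘ₗ Linear.leftComp k Y Z.property.getIso.inv)
    refine ⟨g, LinearMap.ext fun a ↦ ?_⟩
    have := hg (Z.property.getIso.hom ≫ a)
    simpa [trEssImage] using this

lemma exists_map {Z Z' : F.EssImageSubcategory} (f : Z ⟶ Z') :
    ∃ g : N.obj Z.property.witness ⟶ N.obj Z'.property.witness,
      ∀ a, t.trEssImage Z' (a ≫ g) = t.trEssImage Z (f.hom ≫ a) :=
  (t.isPerfect_trEssImage Z' _).exists_eq (t.trEssImage Z ∘ₗ Linear.leftComp k _ f.hom)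

/-- The functor on the essential image of `F` determined by a `SerreTrace`. -/
noncomputable def functor : F.EssImageSubcategory ⥤ T where
  obj Z := N.obj Z.property.witness
  -- The image of `f` is its adjoint with respect to the two forms; uniqueness of adjoints yields
  -- the functor laws.
  map f := (t.exists_map f).choose
  map_id Z := (t.isPerfect_trEssImage Z _).hom_ext fun a ↦ by
    rw [(t.exists_map (𝟙 Z)).choose_spec]
    simp
  map_comp {Z Z' Z''} f g := (t.isPerfect_trEssImage Z'' _).hom_ext fun a ↦ by
    rw [(t.exists_map (f ≫ g)).choose_spec, ← Category.assoc, (t.exists_map g).choose_spec,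
      ← Category.assoc, (t.exists_map f).choose_spec]
    simp

/-- The linear form on `Z ⟶ t.functor.obj Z`. -/
noncomputable def functorTr (Z : F.EssImageSubcategory) : (Z.obj ⟶ t.functor.obj Z) →ₗ[k] I :=
  t.trEssImage Z

lemma isPerfect_functorTr (Z : F.EssImageSubcategory) (Y : T) : IsPerfect (t.functorTr Z) Y :=
  t.isPerfect_trEssImage Z Y

lemma functorTr_comp_map {Z Z' : F.EssImageSubcategory} (f : Z ⟶ Z')
    (a : Z'.obj ⟶ t.functor.obj Z) :
    t.functorTr Z' (a ≫ t.functor.map f) = t.functorTr Z (f.hom ≫ a) :=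
  (t.exists_map f).choose_spec a

/-- The duality isomorphism. -/
noncomputable def duality (Z : F.EssImageSubcategory) (Y : T) :
    ((Z.obj ⟶ Y) →ₗ[k] I) ≃ₗ[k] (Y ⟶ t.functor.obj Z) :=
  (LinearEquiv.ofBijective _ (t.isPerfect_functorTr Z Y)).symm

lemma functorTr_comp_duality (Z : F.EssImageSubcategory) {Y : T} (φ : (Z.obj ⟶ Y) →ₗ[k] I)
    (a : Z.obj ⟶ Y) : t.functorTr Z (a ≫ t.duality Z Y φ) = φ a :=
  LinearMap.congr_fun
    ((LinearEquiv.ofBijective _ (t.isPerfect_functorTr Z Y)).apply_symm_apply φ) a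

/-- The partial Serre functor on the essential image of `F` determined by a `SerreTrace`. -/
noncomputable def partialSerreFunctor : PartialSerreFunctor k I F.essImage where
  functor := t.functor
  duality := t.duality
  duality_naturality_right Z Y Y' g φ φ' h := (t.isPerfect_functorTr Z _).hom_ext fun a ↦ by
    rw [t.functorTr_comp_duality Z φ a, ← Category.assoc, t.functorTr_comp_duality, h]
  duality_naturality_left {Z Z'} f Y φ φ' h := (t.isPerfect_functorTr Z' _).hom_ext fun a ↦ by
    rw [t.functorTr_comp_duality Z' φ' a, ← Category.assoc, t.functorTr_comp_map,
      ← Category.assoc, t.functorTr_comp_duality, h]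

/-- The value of the functor is computed from a chosen witness, which need not be `X`. Both objects
represent `Y ↦ Hom(F X, Y)^*`, so they are isomorphic, and compatibility with the forms makes the
isomorphism natural. -/
lemma exists_iso (X : A) : ∃ e : t.functor.obj (F.toEssImage.obj X) ≅ N.obj X,
    ∀ a : F.obj X ⟶ t.functor.obj (F.toEssImage.obj X),
      t.tr X (a ≫ e.hom) = t.functorTr (F.toEssImage.obj X) a := by
  obtain ⟨f, hf⟩ := (t.isPerfect X (t.functor.obj (F.toEssImage.obj X))).exists_eq
    (t.functorTr (F.toEssImage.obj X))
  obtain ⟨g, hg⟩ : ∃ g : N.obj X ⟶ t.functor.obj (F.toEssImage.obj X), ∀ a : F.obj X ⟶ N.obj X,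
      t.functorTr (F.toEssImage.obj X) (a ≫ g) = t.tr X a :=
    (t.isPerfect_functorTr (F.toEssImage.obj X) (N.obj X)).exists_eq (t.tr X)
  refine ⟨⟨f, g, (t.isPerfect_functorTr (F.toEssImage.obj X) _).hom_ext fun a ↦ ?_,
    (t.isPerfect X _).hom_ext fun a ↦ ?_⟩, hf⟩
  · rw [Category.comp_id, ← Category.assoc]
    exact (hg _).trans (hf a)
  · rw [Category.comp_id, ← Category.assoc, hf]
    exact hg a

/-- The partial Serre functor determined by a `SerreTrace` is given by `N`. -/
noncomputable def toEssImageCompFunctorIso : F.toEssImage ⋙ t.functor ≅ N :=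
  NatIso.ofComponents (fun X ↦ (t.exists_iso X).choose) fun {X X'} f ↦
    (t.isPerfect X' _).hom_ext fun a ↦ by
      rw [← Category.assoc, (t.exists_iso X').choose_spec, ← Category.assoc, t.tr_comp_map,
        ← Category.assoc, (t.exists_iso X).choose_spec]
      exact t.functorTr_comp_map (F.toEssImage.map f) a

end SerreTrace

end Trace

end PartialSerre

/-! ### Total traces and duals of finitely supported cochains -/

namespace PartialSerre

open CochainComplex CochainComplex.HomComplex HomotopyCategory Limits

section ComplexTrace

universe v₁ u₁

variable {k : Type w} [CommRing k]

/-- Linear maps to an injective module extend along linear maps. -/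
lemma exists_comp_eq_of_ker_le {I : ModuleCat.{v₁} k} [Injective I] {A B : Type v₁}
    [AddCommGroup A] [Module k A] [AddCommGroup B] [Module k B] (f : A →ₗ[k] B) (φ : A →ₗ[k] I)
    (h : ∀ a, f a = 0 → φ a = 0) : ∃ ψ : B →ₗ[k] I, ∀ a, ψ (f a) = φ a := by
  let i : (A ⧸ LinearMap.ker f) →ₗ[k] B := (LinearMap.ker f).liftQ f le_rfl
  let φ' : (A ⧸ LinearMap.ker f) →ₗ[k] I := (LinearMap.ker f).liftQ φ (fun a ha ↦ h a ha)
  have : Mono (ModuleCat.ofHom i) := by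
    rw [ModuleCat.mono_iff_injective]
    exact LinearMap.ker_eq_bot.1 (Submodule.ker_liftQ_eq_bot _ _ _ le_rfl)
  refine ⟨(Injective.factorThru (ModuleCat.ofHom φ') (ModuleCat.ofHom i)).hom, fun a ↦ ?_⟩
  exact LinearMap.congr_fun (congrArg ModuleCat.Hom.hom
    (Injective.comp_factorThru (ModuleCat.ofHom φ') (ModuleCat.ofHom i)))
      (Submodule.Quotient.mk a)

/-- A linear form on `E` extends to `B` along a linear relation between `E` and `B`. -/
lemma exists_eq_of_relation {I : ModuleCat.{v₁} k} [Injective I] {E B : Type v₁}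
    [AddCommGroup E] [Module k E] [AddCommGroup B] [Module k B] (S : Submodule k (E × B))
    (φ : E →ₗ[k] I) (h : ∀ e, (e, (0 : B)) ∈ S → φ e = 0) :
    ∃ ψ : B →ₗ[k] I, ∀ e b, (e, b) ∈ S → ψ b = φ e := by
  obtain ⟨ψ, hψ⟩ := exists_comp_eq_of_ker_le (LinearMap.snd k E B ∘ₗ S.subtype)
    (φ ∘ₗ LinearMap.fst k E B ∘ₗ S.subtype) (by
      rintro ⟨⟨e, b⟩, hb⟩ (rfl : b = 0)
      exact h e hb)
  exact ⟨ψ, fun e b hb ↦ hψ ⟨(e, b), hb⟩⟩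

variable {C : Type u₁} [Category.{v₁} C] [Preadditive C] [Linear k C]

/-- Linear forms on `V.X n ⟶ W.X n` that define perfect pairings and are compatible with the
differentials (up to sign). -/
structure ComplexTrace (I : ModuleCat.{v₁} k) (V W : CochainComplex C ℤ) where
  /-- the linear form in degree `n` -/
  tr (n : ℤ) : (V.X n ⟶ W.X n) →ₗ[k] I
  isPerfect (n : ℤ) (Y : C) : IsPerfect (tr n) Y
  tr_d (n : ℤ) (a : V.X (n + 1) ⟶ W.X n) :
    tr (n + 1) (a ≫ W.d n (n + 1)) = -tr n (V.d n (n + 1) ≫ a)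

namespace ComplexTrace

variable {I : ModuleCat.{v₁} k} {V W : CochainComplex C ℤ} (t : ComplexTrace I V W)

/-- The total trace of a family of morphisms. -/
noncomputable def str (b : ∀ n, V.X n ⟶ W.X n) : I := ∑ᶠ n, t.tr n (b n)

lemma finite_support_tr {b : ∀ n, V.X n ⟶ W.X n} (hb : {n | b n ≠ 0}.Finite) :
    (Function.support fun n ↦ t.tr n (b n)).Finite :=
  hb.subset fun n hn h0 ↦ hn (by simp only [h0, map_zero])

lemma str_add {b b' : ∀ n, V.X n ⟶ W.X n} (hb : {n | b n ≠ 0}.Finite)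
    (hb' : {n | b' n ≠ 0}.Finite) : t.str (fun n ↦ b n + b' n) = t.str b + t.str b' := by
  simp only [str, map_add]
  exact finsum_add_distrib (t.finite_support_tr hb) (t.finite_support_tr hb')

lemma str_smul (c : k) {b : ∀ n, V.X n ⟶ W.X n} (hb : {n | b n ≠ 0}.Finite) :
    t.str (fun n ↦ c • b n) = c • t.str b := by
  simp only [str, map_smul]
  exact (smul_finsum' c (t.finite_support_tr hb)).symm

/-- By `tr_d` the trace of the degree `n` component is `s n - s (n - 1)`, a telescoping sum whose
total vanishes when `s` has finite support. -/
lemma str_δ (z : Cochain V W (-1)) (hz : {n : ℤ | z.v (n + 1) n (by omega) ≠ 0}.Finite) :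
    t.str (fun n ↦ (δ (-1) 0 z).v n n (add_zero n)) = 0 := by
  let s (n : ℤ) : I := t.tr n (V.d n (n + 1) ≫ z.v (n + 1) n (by omega))
  have hs : (Function.support s).Finite :=
    hz.subset fun n hn h0 ↦ hn (by simp only [s, h0, comp_zero, map_zero])
  have hs' : (Function.support (fun n ↦ s (n - 1))).Finite := by
    refine (hs.image (· + 1)).subset fun n hn ↦ ⟨n - 1, hn, by simp⟩
  have h (n : ℤ) : t.tr n ((δ (-1) 0 z).v n n (add_zero n)) = s n - s (n - 1) := by
    obtain ⟨m, rfl⟩ : ∃ m, n = m + 1 := ⟨n - 1, by simp⟩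
    have e : s (m + 1 - 1) = s m := by rw [add_sub_cancel_right]
    rw [δ_v (-1) 0 (by simp) z (m + 1) (m + 1) (add_zero _) m (m + 1 + 1) (by simp) rfl, e,
      Int.negOnePow_zero, one_smul, map_add, t.tr_d, neg_add_eq_sub]
  simp only [str, h]
  rw [finsum_sub_distrib hs hs', sub_eq_zero]
  exact (finsum_comp_equiv (Equiv.subRight (1 : ℤ)) (f := s)).symm

lemma str_single (m : ℤ) {b : ∀ n, V.X n ⟶ W.X n} (hb : ∀ n, n ≠ m → b n = 0) :
    t.str b = t.tr m (b m) :=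
  finsum_eq_single _ m fun n hn ↦ by rw [hb n hn, map_zero]

section Pairing

variable {X : CochainComplex C ℤ}

lemma finite_ne_zero_of_bounded {a b : ℤ} (hX : ∀ n, n < a ∨ b < n → IsZero (X.X n))
    {A B : ℤ → C} (p : ∀ n, A n ⟶ X.X n) (c : ∀ n, X.X n ⟶ B n) : {n | p n ≫ c n ≠ 0}.Finite :=
  (Set.finite_Icc a b).subset fun n hn ↦ by
    by_contra h
    refine hn ?_
    rw [(hX n (by simpa [Set.mem_Icc, imp_iff_not_or] using h)).eq_of_tgt (p n) 0, zero_comp]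

end Pairing

/-- Finitely supported families of morphisms. -/
abbrev FinHom (V Y : CochainComplex C ℤ) := Π₀ n : ℤ, (V.X n ⟶ Y.X n)

lemma finite_ne_zero_of_finHom {Y : CochainComplex C ℤ} (f : FinHom V Y)
    (β : ∀ n, Y.X n ⟶ W.X n) : {n | f n ≫ β n ≠ 0}.Finite :=
  f.finite_support.subset fun n hn h0 ↦ hn (by rw [h0, zero_comp])

/-- The linear form on `FinHom V Y` given by a family `Y.X n ⟶ W.X n`. -/
noncomputable def linearForm {Y : CochainComplex C ℤ} (β : ∀ n, Y.X n ⟶ W.X n) :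
    FinHom V Y →ₗ[k] I where
  toFun f := t.str (fun n ↦ f n ≫ β n)
  map_add' f g := by
    simp only [DFinsupp.add_apply, Preadditive.add_comp]
    exact t.str_add (finite_ne_zero_of_finHom f β) (finite_ne_zero_of_finHom g β)
  map_smul' c f := by
    simp only [DFinsupp.smul_apply, Linear.smul_comp]
    exact t.str_smul c (finite_ne_zero_of_finHom f β)

lemma linearForm_single {Y : CochainComplex C ℤ} (β : ∀ n, Y.X n ⟶ W.X n) (m : ℤ)
    (f : V.X m ⟶ Y.X m) : t.linearForm β (DFinsupp.single m f : FinHom V Y) = t.tr m (f ≫ β m) := by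
  refine (t.str_single m fun n hn ↦ ?_).trans (by rw [DFinsupp.single_eq_same])
  rw [DFinsupp.single_eq_of_ne hn, zero_comp]

/-- A linear form on `FinHom V Y` which vanishes on coboundaries is given by a morphism of
complexes. -/
lemma exists_linearForm_eq {Y : CochainComplex C ℤ} (ψ : FinHom V Y →ₗ[k] I)
    (h : ∀ (n : ℤ) (a : V.X (n + 1) ⟶ Y.X n), ψ ((DFinsupp.single (n + 1) (a ≫ Y.d n (n + 1)) : FinHom V Y) +
      (DFinsupp.single n (V.d n (n + 1) ≫ a) : FinHom V Y)) = 0) :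
    ∃ β : Y ⟶ W, t.linearForm β.f = ψ := by
  -- A form on a direct sum is a family of forms, each represented by some `β n`; vanishing on
  -- coboundaries says that the `β n` commute with the differentials.
  choose β hβ using fun n ↦ (t.isPerfect n (Y.X n)).exists_eq (ψ ∘ₗ DFinsupp.lsingle (R := k) (M := fun n : ℤ ↦ (V.X n ⟶ Y.X n)) n)
  replace hβ (n : ℤ) (a : V.X n ⟶ Y.X n) : t.tr n (a ≫ β n) =
      ψ (DFinsupp.single n a : FinHom V Y) := hβ n a
  refine ⟨{ f := β, comm' := ?_ }, ?_⟩
  · rintro n _ rfl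
    refine (t.isPerfect (n + 1) _).hom_ext fun a ↦ ?_
    rw [← Category.assoc, t.tr_d, ← Category.assoc, ← Category.assoc, hβ, hβ, neg_eq_iff_add_eq_zero,
      add_comm, ← map_add, h]
  · refine DFinsupp.lhom_ext fun n a ↦ ?_
    rw [linearForm_single]
    exact hβ n a

/-- The differential on finitely supported cochains of degree zero. -/
def finδ (V Y : CochainComplex C ℤ) : FinHom V Y →ₗ[k] ∀ n : ℤ, (V.X n ⟶ Y.X (n + 1)) where
  toFun f n := f n ≫ Y.d n (n + 1) - V.d n (n + 1) ≫ f (n + 1)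
  map_add' f g := by
    ext n
    simp only [DFinsupp.add_apply, Preadditive.add_comp, Preadditive.comp_add, Pi.add_apply]
    abel
  map_smul' c f := by
    ext n
    simp [smul_sub]

lemma finδ_single {Y : CochainComplex C ℤ} (m : ℤ) (f : V.X (m + 1) ⟶ Y.X (m + 1)) :
    finδ (k := k) V Y (DFinsupp.single (m + 1) f) =
      Pi.single (M := fun n : ℤ ↦ (V.X n ⟶ Y.X (n + 1))) (m + 1) (f ≫ Y.d (m + 1) (m + 1 + 1)) -
        Pi.single (M := fun n : ℤ ↦ (V.X n ⟶ Y.X (n + 1))) m (V.d m (m + 1) ≫ f) := by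
  funext n
  change (DFinsupp.single (m + 1) f : FinHom V Y) n ≫ _ -
    _ ≫ (DFinsupp.single (m + 1) f : FinHom V Y) (n + 1) = _
  rw [Pi.sub_apply]
  congr 1
  · by_cases hn : n = m + 1
    · subst hn
      rw [DFinsupp.single_eq_same, Pi.single_eq_same]
    · rw [DFinsupp.single_eq_of_ne hn, Pi.single_eq_of_ne hn, zero_comp]
  · by_cases hn : n = m
    · subst hn
      rw [DFinsupp.single_eq_same, Pi.single_eq_same]
    · rw [DFinsupp.single_eq_of_ne (by simpa using hn), Pi.single_eq_of_ne hn, comp_zero]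

/-- If the linear form given by a morphism of complexes factors through the differential, then
the morphism is null-homotopic. -/
lemma exists_δ_eq_of_linearForm {Y : CochainComplex C ℤ} (β : Y ⟶ W)
    (χ : (∀ n : ℤ, (V.X n ⟶ Y.X (n + 1))) →ₗ[k] I)
    (h : t.linearForm β.f = χ ∘ₗ finδ V Y) :
    ∃ α : Cochain Y W (-1), δ (-1) 0 α = Cochain.ofHom β ∧
      ∀ n : ℤ, (∀ g : V.X n ⟶ Y.X (n + 1),
        χ (Pi.single (M := fun n : ℤ ↦ (V.X n ⟶ Y.X (n + 1))) n g) = 0) → α.v (n + 1) n (by omega) = 0 := by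
  -- Although `χ` lives on the full product, its values on families concentrated in one degree
  -- suffice: `finδ` of a family concentrated in one degree is a difference of two of those.
  choose α hα using fun n ↦ (t.isPerfect n (Y.X (n + 1))).exists_eq
    (χ ∘ₗ LinearMap.single k (fun n : ℤ ↦ (V.X n ⟶ Y.X (n + 1))) n)
  replace hα (n : ℤ) (a : V.X n ⟶ Y.X (n + 1)) : t.tr n (a ≫ α n) =
      χ (Pi.single (M := fun n : ℤ ↦ (V.X n ⟶ Y.X (n + 1))) n a) := hα n a
  let α' : Cochain Y W (-1) := Cochain.mk fun p q hpq ↦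
    (Y.XIsoOfEq (show p = q + 1 by omega)).hom ≫ α q
  have hα' (n : ℤ) : α'.v (n + 1) n (by omega) = α n := by simp [α']
  refine ⟨α', ?_, fun n hn ↦ ?_⟩
  · ext n
    obtain ⟨m, rfl⟩ : ∃ m, n = m + 1 := ⟨n - 1, by simp⟩
    refine (t.isPerfect (m + 1) _).hom_ext fun a ↦ ?_
    rw [Cochain.ofHom_v, ← linearForm_single, h, LinearMap.comp_apply, finδ_single, map_sub,
      ← hα, ← hα, δ_v (-1) 0 (by simp) α' (m + 1) (m + 1) (add_zero _) m (m + 1 + 1) (by simp) rfl,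
      hα', hα', Int.negOnePow_zero, one_smul, Preadditive.comp_add, map_add, ← Category.assoc,
      t.tr_d, ← Category.assoc, ← Category.assoc]
    abel
  · rw [hα']
    exact (t.isPerfect n _).hom_ext fun a ↦ by rw [hα, hn, comp_zero, map_zero]

end ComplexTrace

end ComplexTrace

end PartialSerre

/-! ### The trace pairing on homotopy classes -/

namespace PartialSerre

open CochainComplex CochainComplex.HomComplex HomotopyCategory Limits

section PairK

universe v₁ u₁

variable {k : Type w} [CommRing k] {C : Type u₁} [Category.{v₁} C] [Preadditive C] [Linear k C]

/-- Bounded complexes. -/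
def IsBounded (X : CochainComplex C ℤ) : Prop := ∃ a b : ℤ, ∀ n, n < a ∨ b < n → IsZero (X.X n)

namespace ComplexTrace

lemma finite_comp {X : CochainComplex C ℤ} (hX : IsBounded X) {A B : ℤ → C}
    (p : ∀ n, A n ⟶ X.X n) (c : ∀ n, X.X n ⟶ B n) : {n | p n ≫ c n ≠ 0}.Finite :=
  let ⟨_, _, h⟩ := hX
  finite_ne_zero_of_bounded h p c

variable {I : ModuleCat.{v₁} k} {V W V' W' : CochainComplex C ℤ} (t : ComplexTrace I V W)
  (t' : ComplexTrace I V' W') {X X' : CochainComplex C ℤ}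

/-- A null-homotopy of `p` composed with `c` makes `p ≫ c` a coboundary. It factors through the
bounded complex `X`, so its support is finite and `str_δ` applies. -/
lemma str_comp_eq_zero_of_left (hX : IsBounded X) (p : V ⟶ X) (c : X ⟶ W)
    (hp : (quotient C (ComplexShape.up ℤ)).map p = 0) :
    t.str (fun n ↦ p.f n ≫ c.f n) = 0 := by
  obtain ⟨h, hh⟩ := exists_δ_eq_of_quotient_map_eq (f := p) (g := 0) (by simpa using hp)
  rw [Cochain.ofHom_zero, zero_add] at hh
  refine Eq.trans ?_ (t.str_δ (h.comp (Cochain.ofHom c) (add_zero (-1))) ?_)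
  · congr 1
    funext n
    rw [δ_comp_ofHom, Cochain.comp_zero_cochain_v, ← hh, Cochain.ofHom_v, Cochain.ofHom_v]
  · obtain ⟨a, b, hX⟩ := hX
    refine (Set.finite_Icc a b).subset fun n hn ↦ ?_
    by_contra hn'
    refine hn ?_
    rw [Cochain.comp_zero_cochain_v, (hX n (by
      simpa [Set.mem_Icc, imp_iff_not_or] using hn')).eq_of_tgt (h.v _ _ _) 0, zero_comp]

lemma str_comp_eq_zero_of_right (hX : IsBounded X) (p : V ⟶ X) (c : X ⟶ W)
    (hc : (quotient C (ComplexShape.up ℤ)).map c = 0) :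
    t.str (fun n ↦ p.f n ≫ c.f n) = 0 := by
  obtain ⟨h, hh⟩ := exists_δ_eq_of_quotient_map_eq (f := c) (g := 0) (by simpa using hc)
  rw [Cochain.ofHom_zero, zero_add] at hh
  refine Eq.trans ?_ (t.str_δ ((Cochain.ofHom p).comp h (zero_add (-1))) ?_)
  · congr 1
    funext n
    rw [δ_ofHom_comp, Cochain.zero_cochain_comp_v, ← hh, Cochain.ofHom_v, Cochain.ofHom_v]
  · obtain ⟨a, b, hX⟩ := hX
    -- The component from degree `n + 1` to degree `n` passes through `X` in degree `n + 1`, which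
    -- shifts the window by one.
    refine (Set.finite_Icc (a - 1) (b - 1)).subset fun n hn ↦ ?_
    by_contra hn'
    refine hn ?_
    rw [Cochain.zero_cochain_comp_v, (hX (n + 1) (by
      simp only [Set.mem_Icc] at hn'
      omega)).eq_of_src (h.v _ _ _) 0, comp_zero]

lemma str_comp_add_left (hX : IsBounded X) (p p' : V ⟶ X) (c : X ⟶ W) :
    t.str (fun n ↦ (p + p').f n ≫ c.f n) =
      t.str (fun n ↦ p.f n ≫ c.f n) + t.str (fun n ↦ p'.f n ≫ c.f n) := by
  rw [← t.str_add (finite_comp hX _ _) (finite_comp hX _ _)]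
  simp

lemma str_comp_add_right (hX : IsBounded X) (p : V ⟶ X) (c c' : X ⟶ W) :
    t.str (fun n ↦ p.f n ≫ (c + c').f n) =
      t.str (fun n ↦ p.f n ≫ c.f n) + t.str (fun n ↦ p.f n ≫ c'.f n) := by
  rw [← t.str_add (finite_comp hX _ _) (finite_comp hX _ _)]
  simp

lemma str_comp_congr (hX : IsBounded X) {p p' : V ⟶ X} {c c' : X ⟶ W}
    (hp : (quotient C (ComplexShape.up ℤ)).map p = (quotient C (ComplexShape.up ℤ)).map p')
    (hc : (quotient C (ComplexShape.up ℤ)).map c = (quotient C (ComplexShape.up ℤ)).map c') :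
    t.str (fun n ↦ p.f n ≫ c.f n) = t.str (fun n ↦ p'.f n ≫ c'.f n) := by
  obtain ⟨p, rfl⟩ : ∃ r, p = p' + r := ⟨p - p', by abel⟩
  obtain ⟨c, rfl⟩ : ∃ r, c = c' + r := ⟨c - c', by abel⟩
  rw [Functor.map_add, add_eq_left] at hp hc
  rw [t.str_comp_add_left hX, t.str_comp_eq_zero_of_left hX p _ hp, add_zero,
    t.str_comp_add_right hX, t.str_comp_eq_zero_of_right hX _ c hc, add_zero]

/-- The pairing between morphisms `V ⟶ X` and `X ⟶ W` in the homotopy category, for a bounded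
complex `X`. -/
noncomputable def pairK (p : (quotient C (ComplexShape.up ℤ)).obj V ⟶ (quotient C _).obj X)
    (c : (quotient C (ComplexShape.up ℤ)).obj X ⟶ (quotient C _).obj W) : I :=
  t.str fun n ↦ ((quotient C _).map_surjective p).choose.f n ≫
    ((quotient C _).map_surjective c).choose.f n

lemma pairK_map (hX : IsBounded X) (p : V ⟶ X) (c : X ⟶ W) :
    t.pairK ((quotient C _).map p) ((quotient C _).map c) = t.str (fun n ↦ p.f n ≫ c.f n) :=
  t.str_comp_congr hX ((quotient C _).map_surjective _).choose_spec
    ((quotient C _).map_surjective _).choose_spec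

/-- The pairing `pairK`, as a linear form in the second variable. -/
noncomputable def pairKLeft (hX : IsBounded X)
    (p : (quotient C (ComplexShape.up ℤ)).obj V ⟶ (quotient C _).obj X) :
    ((quotient C (ComplexShape.up ℤ)).obj X ⟶ (quotient C _).obj W) →ₗ[k] I where
  toFun c := t.pairK p c
  map_add' c c' := by
    obtain ⟨p, rfl⟩ := (quotient C _).map_surjective p
    obtain ⟨c, rfl⟩ := (quotient C _).map_surjective c
    obtain ⟨c', rfl⟩ := (quotient C _).map_surjective c'
    rw [← Functor.map_add, t.pairK_map hX, t.pairK_map hX, t.pairK_map hX,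
      t.str_comp_add_right hX]
  map_smul' r c := by
    obtain ⟨p, rfl⟩ := (quotient C _).map_surjective p
    obtain ⟨c, rfl⟩ := (quotient C _).map_surjective c
    rw [← Functor.map_smul, t.pairK_map hX, t.pairK_map hX, RingHom.id_apply,
      ← t.str_smul r (finite_comp hX _ _)]
    simp

/-- The pairing `pairK`, as a linear form in the first variable. -/
noncomputable def pairKRight (hX : IsBounded X)
    (c : (quotient C (ComplexShape.up ℤ)).obj X ⟶ (quotient C _).obj W) :
    ((quotient C (ComplexShape.up ℤ)).obj V ⟶ (quotient C _).obj X) →ₗ[k] I where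
  toFun p := t.pairK p c
  map_add' p p' := by
    obtain ⟨c, rfl⟩ := (quotient C _).map_surjective c
    obtain ⟨p, rfl⟩ := (quotient C _).map_surjective p
    obtain ⟨p', rfl⟩ := (quotient C _).map_surjective p'
    rw [← Functor.map_add, t.pairK_map hX, t.pairK_map hX, t.pairK_map hX,
      t.str_comp_add_left hX]
  map_smul' r p := by
    obtain ⟨p, rfl⟩ := (quotient C _).map_surjective p
    obtain ⟨c, rfl⟩ := (quotient C _).map_surjective c
    rw [← Functor.map_smul, t.pairK_map hX, t.pairK_map hX, RingHom.id_apply,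
      ← t.str_smul r (finite_comp hX _ _)]
    simp

lemma pairK_comp (hX : IsBounded X) (hX' : IsBounded X')
    (p : (quotient C (ComplexShape.up ℤ)).obj V ⟶ (quotient C _).obj X)
    (f : (quotient C (ComplexShape.up ℤ)).obj X ⟶ (quotient C _).obj X')
    (c : (quotient C (ComplexShape.up ℤ)).obj X' ⟶ (quotient C _).obj W) :
    t.pairK (p ≫ f) c = t.pairK p (f ≫ c) := by
  obtain ⟨p, rfl⟩ := (quotient C _).map_surjective p
  obtain ⟨f, rfl⟩ := (quotient C _).map_surjective f
  obtain ⟨c, rfl⟩ := (quotient C _).map_surjective c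
  rw [← Functor.map_comp, ← Functor.map_comp, t.pairK_map hX', t.pairK_map hX]
  simp

lemma pairK_comp_map (hX : IsBounded X) (f : V ⟶ V') (g : W ⟶ W')
    (hfg : ∀ n (b : V'.X n ⟶ W.X n), t'.tr n (b ≫ g.f n) = t.tr n (f.f n ≫ b))
    (p : (quotient C (ComplexShape.up ℤ)).obj V' ⟶ (quotient C _).obj X)
    (c : (quotient C (ComplexShape.up ℤ)).obj X ⟶ (quotient C _).obj W) :
    t'.pairK p (c ≫ (quotient C _).map g) = t.pairK ((quotient C _).map f ≫ p) c := by
  obtain ⟨p, rfl⟩ := (quotient C _).map_surjective p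
  obtain ⟨c, rfl⟩ := (quotient C _).map_surjective c
  rw [← Functor.map_comp, ← Functor.map_comp, t.pairK_map hX, t'.pairK_map hX]
  simp only [str, HomologicalComplex.comp_f, Category.assoc, ← hfg]

end ComplexTrace

end PairK

end PartialSerre

/-! ### The two duality theorems for complexes -/

namespace PartialSerre

open CochainComplex CochainComplex.HomComplex HomotopyCategory Limits

section Duality

universe v₁ u₁

variable {k : Type w} [CommRing k] {C : Type u₁} [Category.{v₁} C] [Abelian C] [Linear k C]

namespace ComplexTrace

variable {I : ModuleCat.{v₁} k} [Injective I] {V W : CochainComplex C ℤ} (t : ComplexTrace I V W)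

/-- The coboundary of a cochain concentrated in one degree. -/
lemma single_add_single_eq_δ {Y : CochainComplex C ℤ} (n : ℤ) (a : V.X (n + 1) ⟶ Y.X n) (m : ℤ) :
    ((DFinsupp.single (n + 1) (a ≫ Y.d n (n + 1)) : FinHom V Y) +
      (DFinsupp.single n (V.d n (n + 1) ≫ a) : FinHom V Y)) m =
        (δ (-1) 0 (Cochain.single a (-1))).v m m (add_zero m) := by
  rw [DFinsupp.add_apply, δ_v (-1) 0 (by simp) _ m m (add_zero _) (m - 1) (m + 1) (by simp) rfl,
    Int.negOnePow_zero, one_smul]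
  congr 1
  · by_cases h : m = n + 1
    · subst h
      rw [DFinsupp.single_eq_same]
      generalize_proofs hp hq
      have : n + 1 - 1 = n := by simp
      have key (j : ℤ) (hj : j = n) (hh : n + 1 + -1 = j) : a ≫ Y.d n (n + 1) =
          (Cochain.single a (-1)).v (n + 1) j hh ≫ Y.d j (n + 1) := by
        subst hj
        rw [Cochain.single_v]
      exact key _ this _
    · rw [DFinsupp.single_eq_of_ne h, Cochain.single_v_eq_zero _ _ _ _ _ h, zero_comp]
  · by_cases h : m = n
    · subst h
      rw [DFinsupp.single_eq_same, Cochain.single_v]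
    · rw [DFinsupp.single_eq_of_ne h, Cochain.single_v_eq_zero _ _ _ _ _ (by simpa using h),
        comp_zero]

section Injective

variable {X J : CochainComplex C ℤ}

/-- The relation between morphisms `X ⟶ J` and finitely supported families of morphisms from `V`
to `J`, given by composition with `π : V ⟶ X` up to coboundaries. -/
def precompRelation (k : Type w) [CommRing k] [Linear k C] (π : V ⟶ X) (J : CochainComplex C ℤ) :
    Submodule k ((X ⟶ J) × FinHom V J) where
  carrier := {x | ∃ (w : Cochain V J (-1)) (d : ℤ), (∀ p q hpq, p < d → w.v p q hpq = 0) ∧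
    ∀ n, x.2 n = (Cochain.ofHom (π ≫ x.1) + δ (-1) 0 w).v n n (add_zero n)}
  add_mem' := by
    rintro ⟨a, s⟩ ⟨a', s'⟩ ⟨w, d, hw, h⟩ ⟨w', d', hw', h'⟩
    refine ⟨w + w', min d d', fun p q hpq hp ↦ ?_, fun n ↦ ?_⟩
    · rw [Cochain.add_v, hw _ _ _ (by omega), hw' _ _ _ (by omega), add_zero]
    · dsimp only at h h'
      simp only [Prod.mk_add_mk, DFinsupp.add_apply, h, h', δ_add, Preadditive.comp_add,
        Cochain.ofHom_add, Cochain.add_v]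
      abel
  zero_mem' := ⟨0, 0, fun _ _ _ _ ↦ rfl, fun n ↦ by simp⟩
  smul_mem' := by
    rintro c ⟨a, s⟩ ⟨w, d, hw, h⟩
    refine ⟨c • w, d, fun p q hpq hp ↦ ?_, fun n ↦ ?_⟩
    · rw [Cochain.smul_v, hw _ _ _ hp, smul_zero]
    · dsimp only at h
      simp [h]

/-- Finitely supported cochains `V ⟶ J` have cohomology `Hom_K(X, J)` via `π`, and their dual is the
complex of cochains `J ⟶ W`. -/
theorem bijective_pairK_of_injective (hX : IsBounded X) (b : ℤ) [V.IsStrictlyLE b] (π : V ⟶ X)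
    [QuasiIso π] [∀ n, Injective (J.X n)] :
    Function.Bijective (pairing (t.pairKLeft hX ((quotient C _).map π)) ((quotient C _).obj J)) := by
  obtain ⟨l, r, hlr⟩ := id hX
  constructor
  · rw [← LinearMap.ker_eq_bot, LinearMap.ker_eq_bot']
    intro g hg
    obtain ⟨g, rfl⟩ := (quotient C _).map_surjective g
    -- The form of `g` factors through the differential once it kills finitely supported chain maps.
    -- Such a map is homotopic to some `π ≫ a` by a cochain vanishing in low degrees, so its value
    -- is the pairing of `π` with `a ≫ g`, which is zero.
    obtain ⟨χ, hχ⟩ := exists_comp_eq_of_ker_le (I := I) (finδ (k := k) V J) (t.linearForm g.f) (by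
      intro s hs
      replace hs (n : ℤ) : s n ≫ J.d n (n + 1) = V.d n (n + 1) ≫ s (n + 1) :=
        sub_eq_zero.1 (congrFun hs n)
      let z : V ⟶ J := { f := s, comm' := by rintro n _ rfl; exact hs n }
      obtain ⟨d, hd⟩ : ∃ d, ∀ n < d, s n = 0 := by
        obtain ⟨d, hd⟩ := s.finite_support.bddBelow
        exact ⟨d, fun n hn ↦ by_contra fun h ↦ hn.not_ge (hd h)⟩
      obtain ⟨a, w, ha, hw⟩ := exists_comp_add_δ_of_injective π z d hd
      have h₀ : t.pairK ((quotient C _).map π) ((quotient C _).map a ≫ (quotient C _).map g) = 0 :=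
        LinearMap.congr_fun hg ((quotient C _).map a)
      rw [← Functor.map_comp, t.pairK_map hX] at h₀
      have hw' : {n : ℤ | (w.comp (Cochain.ofHom g) (add_zero (-1))).v (n + 1) n (by omega) ≠
          0}.Finite := (Set.finite_Icc (d - 1) b).subset fun n hn ↦ by
        by_contra hn'
        refine hn ?_
        rw [Cochain.comp_zero_cochain_v]
        rw [Set.mem_Icc, not_and_or] at hn'
        obtain hn' | hn' := hn'
        · rw [hw _ _ _ (by omega), zero_comp]
        · rw [(V.isZero_of_isStrictlyLE b (n + 1) (by omega)).eq_of_src (w.v _ _ _) 0, zero_comp]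
      have h₁ := t.str_δ _ hw'
      change t.str (fun n ↦ z.f n ≫ g.f n) = 0
      refine Eq.trans ?_ ((congrArg₂ (· + ·) h₀ h₁).trans (add_zero 0))
      have hw'' : {n : ℤ | (δ (-1) 0 (w.comp (Cochain.ofHom g) (add_zero (-1)))).v n n
          (add_zero n) ≠ 0}.Finite := (Set.finite_Icc (d - 1) b).subset fun n hn ↦ by
        by_contra hn'
        refine hn ?_
        rw [δ_comp_ofHom, Cochain.comp_zero_cochain_v]
        rw [Set.mem_Icc, not_and_or] at hn'
        obtain hn' | hn' := hn'
        · rw [δ_v (-1) 0 (by simp) w n n (add_zero _) (n - 1) (n + 1) (by simp) rfl,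
            hw _ _ _ (by omega), hw _ _ _ (by omega)]
          simp
        · rw [(V.isZero_of_isStrictlyLE b n (by omega)).eq_of_src ((δ (-1) 0 w).v _ _ _) 0,
            zero_comp]
      rw [← t.str_add (finite_comp hX _ _) hw'']
      congr 1
      funext n
      have := congr(($ha).v n n (add_zero n))
      rw [Cochain.ofHom_v] at this
      rw [this, δ_comp_ofHom]
      simp)
    obtain ⟨α, hα, -⟩ := t.exists_δ_eq_of_linearForm g χ (LinearMap.ext fun s ↦ (hχ s).symm)
    exact quotient_map_eq_zero_of_δ hα
  · intro φ
    -- Transports `φ` to the finitely supported cochains. This is well defined because `a` is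
    -- null-homotopic as soon as `π ≫ a` bounds a cochain vanishing in low degrees.
    obtain ⟨ψ, hψ⟩ := exists_eq_of_relation (I := I) (precompRelation k π J)
      (φ ∘ₗ (quotient C (ComplexShape.up ℤ)).mapLinearMap k) (by
        rintro a ⟨w, d, hw, h⟩
        obtain ⟨α, hα, -⟩ := exists_δ_eq_of_injective π a (-w) (by
          rw [δ_neg, neg_eq_iff_add_eq_zero, add_comm]
          ext n
          exact (h n).symm) (min l d - 1)
          (fun p hp ↦ (hlr p (by omega)).eq_of_src _ _)
          (fun p q hpq hp ↦ by rw [Cochain.neg_v, hw _ _ _ (by omega), neg_zero])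
        have := quotient_map_eq_zero_of_δ hα
        change φ ((quotient C _).map a) = 0
        rw [this, map_zero])
    obtain ⟨g, hg⟩ := t.exists_linearForm_eq ψ fun n a ↦ by
      refine (hψ 0 _ ⟨Cochain.single a (-1), n, fun p q hpq hp ↦
        Cochain.single_v_eq_zero _ _ _ _ _ (by omega), fun m ↦ ?_⟩).trans (map_zero _)
      rw [single_add_single_eq_δ]
      simp
    refine ⟨(quotient C _).map g, LinearMap.ext fun a ↦ ?_⟩
    obtain ⟨a, rfl⟩ := (quotient C _).map_surjective a
    change t.pairK _ ((quotient C _).map a ≫ (quotient C _).map g) = _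
    rw [← Functor.map_comp, t.pairK_map hX]
    have hfin : {n : ℤ | π.f n ≫ a.f n ≠ 0}.Finite := finite_comp hX _ _
    classical
    -- Since `π ≫ a` factors through the bounded complex `X`, it is itself finitely supported and
    -- related to `a` by the zero homotopy.
    let s : FinHom V J := DFinsupp.mk hfin.toFinset fun n ↦ π.f n ≫ a.f n
    have hs (n : ℤ) : s n = π.f n ≫ a.f n := by
      by_cases h : n ∈ hfin.toFinset
      · exact DFinsupp.mk_of_mem h
      · rw [DFinsupp.mk_of_notMem h]
        exact (by simpa using h : π.f n ≫ a.f n = 0).symm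
    have := hψ a s ⟨0, 0, fun _ _ _ _ ↦ rfl, fun n ↦ by simp [hs]⟩
    rw [← hg] at this
    refine Eq.trans ?_ this
    change _ = t.str (fun n ↦ s n ≫ g.f n)
    simp [hs]

end Injective

section Projective

variable {B Y : CochainComplex C ℤ}

/-- The relation between morphisms `V ⟶ Y` and finitely supported families of morphisms from `V`
to `Y`, given by equality in degrees at most `N` up to coboundaries. -/
def truncRelation (k : Type w) [CommRing k] [Linear k C] (V Y : CochainComplex C ℤ) (N : ℤ) :
    Submodule k ((V ⟶ Y) × FinHom V Y) where
  carrier := {x | ∃ w : Cochain V Y (-1), ∀ n ≤ N,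
    x.2 n = (Cochain.ofHom x.1 + δ (-1) 0 w).v n n (add_zero n)}
  add_mem' := by
    rintro ⟨a, s⟩ ⟨a', s'⟩ ⟨w, h⟩ ⟨w', h'⟩
    refine ⟨w + w', fun n hn ↦ ?_⟩
    replace h := h n hn
    replace h' := h' n hn
    dsimp only at h h'
    simp only [Prod.mk_add_mk, DFinsupp.add_apply, h, h', δ_add, Cochain.ofHom_add, Cochain.add_v]
    abel
  zero_mem' := ⟨0, fun n _ ↦ by simp⟩
  smul_mem' := by
    rintro c ⟨a, s⟩ ⟨w, h⟩
    refine ⟨c • w, fun n hn ↦ ?_⟩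
    replace h := h n hn
    dsimp only at h
    simp [h]

/-- Truncation of families of morphisms. -/
def truncFamily (k : Type w) [CommRing k] [Linear k C] (V Y : CochainComplex C ℤ) (N : ℤ) :
    (∀ n : ℤ, (V.X n ⟶ Y.X (n + 1))) →ₗ[k] ∀ n : ℤ, (V.X n ⟶ Y.X (n + 1)) where
  toFun f n := if n ≤ N then f n else 0
  map_add' f g := by
    funext n
    dsimp only [Pi.add_apply]
    split_ifs <;> simp
  map_smul' c f := by
    funext n
    dsimp only [Pi.smul_apply]
    split_ifs <;> simp

/-- The coboundary of `s` vanishes on source degrees at most `N`, so exactness above `N` gives it a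
primitive vanishing up to degree `N + 1`. Subtracting that primitive from `s` gives a chain map
unchanged in degrees at most `N`. -/
lemma exists_eq_hom_of_le (N : ℤ) (hV : ∀ m j, N + 1 ≤ m → HomExactAt V (Y.X j) m)
    (s : ∀ n, V.X n ⟶ Y.X n)
    (hs : ∀ n ≤ N, s n ≫ Y.d n (n + 1) = V.d n (n + 1) ≫ s (n + 1)) :
    ∃ z : V ⟶ Y, ∀ n ≤ N, z.f n = s n := by
  let s' : Cochain V Y 0 := Cochain.ofHoms s
  have hs' : ∀ p q hpq, p < N + 1 → (δ 0 1 s').v p q hpq = 0 := by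
    rintro p _ rfl hp
    rw [δ_v 0 1 (by simp) s' p (p + 1) rfl p (p + 1) (by simp) rfl, Cochain.ofHoms_v,
      Cochain.ofHoms_v, hs p (by omega)]
    simp
  obtain ⟨α, hα, hα'⟩ := exists_δ_eq_of_homExactAt (zero_add 1) (Cocycle.mk (δ 0 1 s') 2
    (by norm_num) (δ_δ _ _ _ _)) (N + 1) hs' hV
  refine ⟨Cocycle.homOf (Cocycle.mk (s' - α) 1 (zero_add 1) (by
    rw [δ_sub, hα]
    exact sub_self _)),
    fun n hn ↦ ?_⟩
  rw [Cocycle.homOf_f]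
  change (s' - α).v n n (add_zero n) = _
  rw [Cochain.sub_v, hα' _ _ _ (by omega), sub_zero, Cochain.ofHoms_v]

/-- Up to homotopy, a morphism `V ⟶ Y` is determined by its components of degree at most `N`, a
finite amount of data. The dual data are cochains `Y ⟶ W` vanishing in high degrees, and these lift
along `c` up to homotopy. -/
theorem bijective_pairK_of_projective (hB : IsBounded B) (e : ℤ) [V.IsStrictlyGE e] (c : B ⟶ W)
    [QuasiIso c] [∀ n, Projective (Y.X n)] (N₀ : ℤ)
    (hV : ∀ (A : C) (m : ℤ), Projective A → N₀ ≤ m → HomExactAt V A m) :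
    Function.Bijective (fun (β : (quotient C (ComplexShape.up ℤ)).obj Y ⟶ (quotient C _).obj B) ↦
      (t.pairKRight hB ((quotient C _).map c)) ∘ₗ
        Linear.rightComp k ((quotient C _).obj V) β) := by
  obtain ⟨l, r, hlr⟩ := id hB
  -- Above `N` the complex `B` vanishes and `Hom(V, A)` is exact for every projective `A`.
  let N := max N₀ r
  have hV' (m j : ℤ) (hm : N + 1 ≤ m) : HomExactAt V (Y.X j) m := hV _ m inferInstance (by omega)
  have hBN (n : ℤ) (hn : N < n) : IsZero (B.X n) := hlr n (by omega)
  have hVe (n : ℤ) (hn : n < e) : IsZero (V.X n) := V.isZero_of_isStrictlyGE e n hn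
  constructor
  · intro b b' hbb'
    obtain ⟨b, rfl⟩ := (quotient C _).map_surjective b
    obtain ⟨b', rfl⟩ := (quotient C _).map_surjective b'
    have hb (a : V ⟶ Y) : t.str (fun n ↦ (a ≫ (b - b')).f n ≫ c.f n) = 0 := by
      have : t.pairK ((quotient C _).map a ≫ (quotient C _).map b) ((quotient C _).map c) =
          t.pairK ((quotient C _).map a ≫ (quotient C _).map b') ((quotient C _).map c) :=
        LinearMap.congr_fun hbb' ((quotient C _).map a)
      rw [← Functor.map_comp, ← Functor.map_comp, t.pairK_map hB, t.pairK_map hB] at this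
      have h := t.str_comp_add_left hB (a ≫ (b - b')) (a ≫ b') c
      rw [← Preadditive.comp_add, sub_add_cancel, this] at h
      simpa using h
    rw [← sub_eq_zero, ← Functor.map_sub]
    generalize b - b' = b at hb
    have hbN (n : ℤ) (hn : N < n) : b.f n = 0 := (hBN n hn).eq_of_tgt _ _
    -- A family that is a chain map up to degree `N` agrees there with a chain map `z`. As `b`
    -- vanishes above `N`, its form has the same value on both, namely zero. Factoring through the
    -- truncated differential makes the homotopy vanish above `N + 1`, as needed to lift it along
    -- `c`.
    obtain ⟨χ, hχ⟩ := exists_comp_eq_of_ker_le (I := I) (truncFamily k V Y N ∘ₗ finδ V Y)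
      (t.linearForm (b ≫ c).f) (by
        intro s hs
        obtain ⟨z, hz⟩ := exists_eq_hom_of_le N hV' s fun n hn ↦
          sub_eq_zero.1 ((if_pos hn).symm.trans (congrFun hs n))
        refine Eq.trans ?_ (hb z)
        change t.str (fun n ↦ s n ≫ (b ≫ c).f n) = _
        congr 1
        funext n
        by_cases hn : n ≤ N
        · simp [hz n hn]
        · simp [hbN n (by omega)])
    obtain ⟨w, hw, hw'⟩ := t.exists_δ_eq_of_linearForm (b ≫ c) (χ ∘ₗ truncFamily k V Y N)
      (LinearMap.ext fun s ↦ (hχ s).symm)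
    obtain ⟨α, hα, -⟩ := exists_δ_eq_of_projective_comp c b w hw (N + 1)
      (fun p hp ↦ hbN p (by omega)) (fun p q hpq hp ↦ by
        obtain rfl : p = q + 1 := by omega
        refine hw' q fun g ↦ ?_
        have : truncFamily k V Y N (Pi.single (M := fun n : ℤ ↦ (V.X n ⟶ Y.X (n + 1))) q g) =
            0 := by
          funext m
          change (if m ≤ N then _ else _) = (0 : V.X m ⟶ Y.X (m + 1))
          split_ifs with hm
          · rw [Pi.single_eq_of_ne (by omega)]
          · rfl
        rw [LinearMap.comp_apply, this, map_zero])
    exact quotient_map_eq_zero_of_δ hα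
  · intro φ
    obtain ⟨ψ, hψ⟩ := exists_eq_of_relation (I := I) (truncRelation k V Y N)
      (φ ∘ₗ (quotient C (ComplexShape.up ℤ)).mapLinearMap k) (by
        rintro z ⟨w, h⟩
        -- Being related to zero means that `z + δ w` vanishes up to degree `N`; exactness above `N`
        -- makes it a coboundary.
        obtain ⟨α, hα, -⟩ := exists_δ_eq_of_homExactAt (neg_add_cancel 1)
          (Cocycle.ofHom z + Cocycle.mk (δ (-1) 0 w) 1 (zero_add 1) (δ_δ _ _ _ _)) (N + 1)
          (by
            intro p q hpq hp
            obtain rfl : p = q := by omega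
            exact (h p (by omega)).symm) hV'
        have : δ (-1) 0 (α - w) = Cochain.ofHom z := by
          rw [δ_sub, hα]
          exact add_sub_cancel_right _ _
        have := quotient_map_eq_zero_of_δ this
        change φ ((quotient C _).map z) = 0
        rw [this, map_zero])
    obtain ⟨β, hβ⟩ := t.exists_linearForm_eq ψ fun n a ↦ by
      refine (hψ 0 _ ⟨Cochain.single a (-1), fun m _ ↦ ?_⟩).trans (map_zero _)
      rw [single_add_single_eq_δ]
      simp
    -- Families concentrated above `N` are related to the zero morphism, so `ψ` kills them. This
    -- vanishing is what allows `β` to lift along `c`.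
    have hβN (n : ℤ) (hn : N < n) : β.f n = 0 := (t.isPerfect n _).hom_ext fun a ↦ by
      have h := hψ 0 (DFinsupp.single n a) ⟨0, fun m hm ↦ by
        dsimp only
        rw [DFinsupp.single_eq_of_ne (by omega)]
        simp⟩
      rw [← hβ, linearForm_single] at h
      rw [h, map_zero, comp_zero, map_zero]
    obtain ⟨b, w, hb, hw⟩ := exists_comp_add_δ_of_projective c β N hβN
    refine ⟨(quotient C _).map b, LinearMap.ext fun a ↦ ?_⟩
    obtain ⟨z, rfl⟩ := (quotient C _).map_surjective a
    change t.pairK ((quotient C _).map z ≫ (quotient C _).map b) _ = _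
    rw [← Functor.map_comp, t.pairK_map hB]
    classical
    -- Truncating at `N` gives finite support because `V` vanishes below `e`.
    let s : FinHom V Y := DFinsupp.mk (Finset.Icc e N) fun n ↦ z.f n
    have hs (n : ℤ) (hn : n ≤ N) : s n = z.f n := by
      by_cases h : n ∈ Finset.Icc e N
      · exact DFinsupp.mk_of_mem h
      · exact (hVe n (by simp only [Finset.mem_Icc] at h; omega)).eq_of_src _ _
    refine Eq.trans ?_ (hψ z s ⟨0, fun n hn ↦ by simp [hs n hn]⟩)
    rw [← hβ]
    change _ = t.str (fun n ↦ s n ≫ β.f n)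
    have hw' : {n : ℤ | ((Cochain.ofHom z).comp w (zero_add (-1))).v (n + 1) n (by omega) ≠
        0}.Finite := (Set.finite_Icc (e - 1) N).subset fun n hn ↦ by
      by_contra hn'
      refine hn ?_
      rw [Cochain.zero_cochain_comp_v]
      rw [Set.mem_Icc, not_and_or] at hn'
      obtain hn' | hn' := hn'
      · rw [Cochain.ofHom_v, (hVe (n + 1) (by omega)).eq_of_src (z.f _) 0, zero_comp]
      · rw [hw _ _ _ (by omega), comp_zero]
    have hw'' : {n : ℤ | (δ (-1) 0 ((Cochain.ofHom z).comp w (zero_add (-1)))).v n n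
        (add_zero n) ≠ 0}.Finite := (Set.finite_Icc e (N + 1)).subset fun n hn ↦ by
      by_contra hn'
      refine hn ?_
      rw [δ_ofHom_comp, Cochain.zero_cochain_comp_v]
      rw [Set.mem_Icc, not_and_or] at hn'
      obtain hn' | hn' := hn'
      · rw [Cochain.ofHom_v, (hVe n (by omega)).eq_of_src (z.f _) 0, zero_comp]
      · rw [δ_v (-1) 0 (by simp) w n n (add_zero _) (n - 1) (n + 1) (by simp) rfl,
          hw _ _ _ (by omega), hw _ _ _ (by omega)]
        simp
    refine Eq.trans (add_zero _).symm ?_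
    rw [← t.str_δ _ hw', ← t.str_add (finite_comp hB _ _) hw'']
    congr 1
    funext n
    by_cases hn : n ≤ N
    · have := congr(($hb).v n n (add_zero n))
      rw [Cochain.ofHom_v] at this
      rw [hs n hn, this, δ_ofHom_comp]
      simp
    -- Above `N` the family `s` plays no role: `β` vanishes, so `b ≫ c` and `δ w` cancel.
    · have h := congr(z.f n ≫ ($hb).v n n (add_zero n))
      simp only [Cochain.ofHom_v, hβN n (by omega), comp_zero] at h
      rw [hβN n (by omega), comp_zero, h, δ_ofHom_comp]
      simp

end Projective

end ComplexTrace

end Duality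

end PartialSerre

/-! ### Dual bases and the trace form of a module -/

namespace PartialSerre

section DualPair

variable {R : Type u} [Ring R]

/-- A duality between a left module `V` and a right module `U`: a bilinear pairing with values in
`R` and a pair of finite dual bases. -/
structure DualPair (V : ModuleCat.{u} R) (U : ModuleCat.{u} Rᵐᵒᵖ) where
  /-- the pairing -/
  pair : V → U → R
  pair_add_left (v v' : V) (u : U) : pair (v + v') u = pair v u + pair v' u
  pair_add_right (v : V) (u u' : U) : pair v (u + u') = pair v u + pair v u'
  pair_smul_left (r : R) (v : V) (u : U) : pair (r • v) u = r * pair v u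
  pair_smul_right (r : R) (v : V) (u : U) : pair v (MulOpposite.op r • u) = pair v u * r
  /-- the length of the dual bases -/
  n : ℕ
  /-- the dual basis of `V` -/
  v : Fin n → V
  /-- the dual basis of `U` -/
  u : Fin n → U
  sum_left (x : V) : ∑ i, pair x (u i) • v i = x
  sum_right (y : U) : ∑ i, MulOpposite.op (pair (v i) y) • u i = y

namespace DualPair

variable {V V' : ModuleCat.{u} R} {U U' : ModuleCat.{u} Rᵐᵒᵖ} (D : DualPair V U)
  (D' : DualPair V' U')

/-- Transport of a dual pair along an isomorphism. -/
def ofIso (e : V' ≅ V) : DualPair V' U where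
  pair x y := D.pair (e.hom x) y
  pair_add_left x x' y := by rw [map_add, D.pair_add_left]
  pair_add_right x y y' := D.pair_add_right _ _ _
  pair_smul_left r x y := by rw [map_smul, D.pair_smul_left]
  pair_smul_right r x y := D.pair_smul_right _ _ _
  n := D.n
  v i := e.inv (D.v i)
  u := D.u
  sum_left x := by
    apply (ConcreteCategory.bijective_of_isIso e.hom).injective
    simp [map_sum, D.sum_left]
  sum_right y := by simp [D.sum_right]

variable {k : Type w} [CommRing k] [Algebra k R] {I : ModuleCat.{u} k}

lemma algebraMap_op_smul (M : ModuleCat.{u} Rᵐᵒᵖ) (c : k) (x : M) :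
    c • x = MulOpposite.op (algebraMap k R c) • x := rfl

lemma pair_algebraMap_smul_right (c : k) (x : V) (y : U) :
    D.pair x (c • y) = algebraMap k R c * D.pair x y := by
  rw [algebraMap_op_smul (R := R), D.pair_smul_right, Algebra.commutes]

/-- The `k`-linear form underlying an element of `star`. -/
def starEval (φ : (star I R).obj (op U)) : U →ₗ[k] I := φ

/-- The trace form of a dual pair. -/
def tr : (V ⟶ (star I R).obj (op U)) →ₗ[k] I where
  toFun h := ∑ i, starEval (h (D.v i)) (D.u i)
  map_add' h h' := by
    rw [← Finset.sum_add_distrib]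
    rfl
  map_smul' c h := by
    rw [RingHom.id_apply, Finset.smul_sum]
    refine Finset.sum_congr rfl fun i _ ↦ ?_
    rw [← map_smul]
    rfl

lemma tr_apply (h : V ⟶ (star I R).obj (op U)) :
    D.tr h = ∑ i, starEval (h (D.v i)) (D.u i) := rfl

/-- The morphism `V ⟶ M`, `v ↦ ⟨v, y⟩ x`. -/
def toHom {M : ModuleCat.{u} R} (x : M) (y : U) : V ⟶ M :=
  ModuleCat.ofHom
    { toFun z := D.pair z y • x
      map_add' z z' := by rw [D.pair_add_left, add_smul]
      map_smul' r z := by rw [D.pair_smul_left, mul_smul, RingHom.id_apply] }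

lemma toHom_apply {M : ModuleCat.{u} R} (x : M) (y : U) (z : V) :
    D.toHom x y z = D.pair z y • x := rfl

/-- Follows by expanding `y` in the dual basis; it recovers every value of `g` from traces, which is
non-degeneracy. -/
lemma tr_toHom_comp {M : ModuleCat.{u} R} (x : M) (y : U) (g : M ⟶ (star I R).obj (op U)) :
    D.tr (D.toHom x y ≫ g) = starEval (g x) y := by
  conv_rhs => rw [← D.sum_right y, map_sum]
  rw [tr_apply]
  refine Finset.sum_congr rfl fun i _ ↦ ?_
  rw [ConcreteCategory.comp_apply, toHom_apply, map_smul]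
  rfl

/-- Morally `Hom_R(M, U^*) ≅ (U ⊗_R M)^*` and `U ⊗_R M ≅ Hom_R(V, M)`, the second map being `toHom`
with inverse given by the dual bases. -/
lemma isPerfect_tr (M : ModuleCat.{u} R) : IsPerfect (D.tr (I := I)) M := by
  constructor
  · intro g g' h
    ext x
    refine LinearMap.ext fun y ↦ ?_
    change starEval (g x) y = starEval (g' x) y
    rw [← D.tr_toHom_comp, ← D.tr_toHom_comp]
    exact LinearMap.congr_fun h _
  · intro φ
    let G (x : M) : U →ₗ[k] I :=
      { toFun y := φ (D.toHom x y)
        map_add' y y' := by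
          rw [← map_add]
          congr 1
          ext z
          exact (congrArg (· • x) (D.pair_add_right z y y')).trans (add_smul _ _ x)
        map_smul' c y := by
          rw [RingHom.id_apply, ← map_smul]
          congr 1
          ext z
          exact (congrArg (· • x) (D.pair_algebraMap_smul_right c z y)).trans (mul_smul _ _ x) }
    let _ := starModule I R U
    let g : M ⟶ (star I R).obj (op U) := ModuleCat.ofHom
      { toFun := G
        map_add' x x' := by
          refine LinearMap.ext fun y ↦ ?_
          change φ _ = φ _ + φ _
          rw [← map_add]
          congr 1
          ext z
          exact smul_add _ _ _
        map_smul' r x := by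
          refine LinearMap.ext fun y ↦ ?_
          change φ _ = φ _
          congr 1
          ext z
          change D.pair z y • r • x = D.pair z (MulOpposite.op r • y) • x
          rw [D.pair_smul_right, mul_smul] }
    refine ⟨g, LinearMap.ext fun a ↦ ?_⟩
    -- The dual basis of `V` gives `a = ∑ toHom (a v_i) u_i`.
    change ∑ i, φ (D.toHom (a (D.v i)) (D.u i)) = φ a
    rw [← map_sum]
    congr 1
    ext x
    rw [ModuleCat.hom_sum, LinearMap.sum_apply]
    conv_rhs => rw [← D.sum_left x, map_sum]
    refine Finset.sum_congr rfl fun i _ ↦ ?_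
    rw [map_smul]
    rfl

/-- Cyclicity of the trace: expand `f v_i` in the dual basis of `V'`, exchange the sums, and
contract the sum over `i` with the dual basis of `U`. -/
lemma tr_comp_map_star (f : V ⟶ V') (f' : U' ⟶ U)
    (h : ∀ x y, D'.pair (f x) y = D.pair x (f' y)) (b : V' ⟶ (star I R).obj (op U)) :
    D'.tr (b ≫ (star I R).map f'.op) = D.tr (f ≫ b) := by
  rw [tr_apply, tr_apply]
  have h₁ (i) : starEval ((f ≫ b) (D.v i)) (D.u i) = ∑ j, starEval (b (D'.v j))
      (MulOpposite.op (D.pair (D.v i) (f' (D'.u j))) • D.u i) := by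
    rw [ConcreteCategory.comp_apply]
    conv_lhs => rw [← D'.sum_left (f (D.v i)), map_sum]
    simp only [h, map_smul]
    exact LinearMap.sum_apply _ _ _
  simp only [h₁]
  rw [Finset.sum_comm]
  refine Finset.sum_congr rfl fun j _ ↦ ?_
  rw [← map_sum, D.sum_right]
  rfl

end DualPair

end DualPair

end PartialSerre

/-! ### Finitely generated projective modules and their duals -/

namespace PartialSerre

section FiniteProjective

lemma exists_dualBasis (S M : Type u) [Ring S] [AddCommGroup M] [Module S M] [Module.Finite S M]
    [Module.Projective S M] :
    ∃ (n : ℕ) (m : Fin n → M) (φ : Fin n → (M →ₗ[S] S)), ∀ x, ∑ i, φ i x • m i = x := by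
  obtain ⟨n, f, g, -, -, h⟩ := Module.Finite.exists_comp_eq_id_of_projective S M
  refine ⟨n, fun i ↦ f (Pi.single i 1), fun i ↦ LinearMap.proj i ∘ₗ g, fun x ↦ ?_⟩
  conv_rhs => rw [← LinearMap.id_apply (R := S) x, ← h, LinearMap.comp_apply,
    ← Finset.univ_sum_single (g x), map_sum]
  refine Finset.sum_congr rfl fun i _ ↦ ?_
  rw [← map_smul, ← Pi.single_smul, smul_eq_mul, mul_one]
  rfl

variable {R : Type u} [Ring R]

/-- The evaluation of elements of `P^∨`. -/
def veeEval {P : ModuleCat.{u} R} (φ : (homInto R Rᵐᵒᵖ R).obj (op P)) : P →ₗ[R] R := φ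

/-- The evaluation of elements of `U^∨`. -/
def veeOpEval {U : ModuleCat.{u} Rᵐᵒᵖ} (φ : (homInto Rᵐᵒᵖ R R).obj (op U)) : U →ₗ[Rᵐᵒᵖ] R := φ

/-- The duality between a finitely generated projective left module `P` and `P^∨`. -/
noncomputable def dualPair (P : ModuleCat.{u} R) [Projective P] [Module.Finite R P] :
    DualPair P ((homInto R Rᵐᵒᵖ R).obj (op P)) :=
  have : Module.Projective R P := (IsProjective.iff_projective P).2 inferInstance
  let h := exists_dualBasis R P
  { pair x φ := veeEval φ x
    pair_add_left x x' φ := map_add _ _ _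
    pair_add_right x φ φ' := rfl
    pair_smul_left r x φ := map_smul _ _ _
    pair_smul_right r x φ := rfl
    n := h.choose
    v := h.choose_spec.choose
    u := h.choose_spec.choose_spec.choose
    sum_left := h.choose_spec.choose_spec.choose_spec
    sum_right φ := by
      refine LinearMap.ext fun x ↦ ?_
      change _ = veeEval φ x
      conv_rhs => rw [← h.choose_spec.choose_spec.choose_spec x, map_sum]
      refine (LinearMap.sum_apply _ _ _).trans (Finset.sum_congr rfl fun i _ ↦ ?_)
      rw [map_smul]
      rfl }

/-- The duality between `U^∨` and a finitely generated projective right module `U`. -/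
noncomputable def dualPairOp (U : ModuleCat.{u} Rᵐᵒᵖ) [Projective U] [Module.Finite Rᵐᵒᵖ U] :
    DualPair ((homInto Rᵐᵒᵖ R R).obj (op U)) U :=
  have : Module.Projective Rᵐᵒᵖ U := (IsProjective.iff_projective U).2 inferInstance
  let h := exists_dualBasis Rᵐᵒᵖ U
  -- Coordinates of `U` take values in `Rᵐᵒᵖ`, whereas elements of `U^∨` take values in `R` as a
  -- right module.
  let e : Rᵐᵒᵖ →ₗ[Rᵐᵒᵖ] R := (MulOpposite.opLinearEquiv Rᵐᵒᵖ).symm.toLinearMap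
  { pair φ x := veeOpEval φ x
    pair_add_left φ φ' x := rfl
    pair_add_right φ x x' := map_add _ _ _
    pair_smul_left r φ x := rfl
    pair_smul_right r φ x := map_smul _ _ _
    n := h.choose
    v i := e ∘ₗ h.choose_spec.choose_spec.choose i
    u := h.choose_spec.choose
    sum_left φ := by
      refine LinearMap.ext fun x ↦ ?_
      change _ = veeOpEval φ x
      conv_rhs => rw [← h.choose_spec.choose_spec.choose_spec x, map_sum]
      refine (LinearMap.sum_apply _ _ _).trans (Finset.sum_congr rfl fun i _ ↦ ?_)
      rw [map_smul]
      rfl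
    sum_right x := h.choose_spec.choose_spec.choose_spec x }

end FiniteProjective

section Complexes

universe v₁ u₁ v₂ u₂

variable {C : Type u₁} [Category.{v₁} C] [Preadditive C]
variable {D : Type u₂} [Category.{v₂} D] [Preadditive D]

/-- The functor on complexes induced by a contravariant additive functor. -/
noncomputable abbrev contravariantCochain (F : Cᵒᵖ ⥤ D) [F.Additive] :
    (CochainComplex C ℤ)ᵒᵖ ⥤ CochainComplex D ℤ :=
  (CochainComplex.opEquivalence C).functor ⋙ F.mapHomologicalComplex (ComplexShape.up ℤ)

variable (F : Cᵒᵖ ⥤ D) [F.Additive]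

lemma isZero_contravariantCochain_X (K : CochainComplex C ℤ) (n : ℤ) (h : Limits.IsZero (K.X (-n))) :
    Limits.IsZero (((contravariantCochain F).obj (op K)).X n) :=
  F.map_isZero h.op

end Complexes

end PartialSerre

/-! ### Degreewise dualities of complexes -/

namespace PartialSerre

open Limits

section Perfect

universe v₁ u₁

variable {k : Type w} [CommRing k] {I : ModuleCat.{v₁} k} {T : Type u₁} [Category.{v₁} T]
  [Preadditive T] [Linear k T]

lemma IsPerfect.units_smul {X S Y : T} {t : (X ⟶ S) →ₗ[k] I} (h : IsPerfect t Y) (ε : ℤˣ) :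
    IsPerfect (ε • t) Y :=
  (MulAction.bijective ε).comp h

/-- `Hom(-, S)` is `Hom(X, -)` followed by `(-)^*`; the former preserves monomorphisms and the
latter turns them into surjections. This shows that `ν P` has injective terms. -/
lemma injective_of_isPerfect [Injective I] {X S : T} {t : (X ⟶ S) →ₗ[k] I}
    (h : ∀ Y, IsPerfect t Y) : Injective S where
  factors {Y Y'} g i _ := by
    obtain ⟨φ, hφ⟩ := exists_comp_eq_of_ker_le (I := I) (Linear.rightComp k X i) (pairing t Y g)
      (fun a ha ↦ by
        have : a = 0 := (cancel_mono i).1 ((show a ≫ i = 0 from ha).trans zero_comp.symm)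
        rw [this, map_zero])
    obtain ⟨g', hg'⟩ := (h Y').exists_eq φ
    refine ⟨g', (h Y).hom_ext fun a ↦ ?_⟩
    rw [← Category.assoc, hg']
    exact hφ a

end Perfect

section DualPair

variable {R : Type u} [Ring R]

namespace DualPair

variable {V : ModuleCat.{u} R} {U : ModuleCat.{u} Rᵐᵒᵖ} (D : DualPair V U)

include D in
lemma projective_left : Projective V := by
  rw [← IsProjective.iff_projective]
  let i : V →ₗ[R] (Fin D.n → R) :=
    { toFun x j := D.pair x (D.u j)
      map_add' x y := funext fun j ↦ D.pair_add_left _ _ _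
      map_smul' r x := funext fun j ↦ D.pair_smul_left _ _ _ }
  refine Module.Projective.of_split i (Fintype.linearCombination R D.v) (LinearMap.ext fun x ↦ ?_)
  exact D.sum_left x

lemma eq_zero_right {y : U} (h : ∀ x, D.pair x y = 0) : y = 0 := by
  rw [← D.sum_right y]
  simp [h]

lemma pair_sum_right {ι : Type*} (s : Finset ι) (x : V) (y : ι → U) :
    D.pair x (∑ i ∈ s, y i) = ∑ i ∈ s, D.pair x (y i) :=
  map_sum (AddMonoidHom.mk' (D.pair x) (D.pair_add_right x)) y s

end DualPair

/-- A degreewise duality between a complex of left modules and a complex of right modules. -/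
structure ComplexDualPair (V : CochainComplex (ModuleCat.{u} R) ℤ)
    (U : CochainComplex (ModuleCat.{u} Rᵐᵒᵖ) ℤ) where
  /-- the duality in degree `n` -/
  pair (n : ℤ) : DualPair (V.X n) (U.X (-n))
  pair_d (n m : ℤ) (x : V.X n) (y : U.X (-m)) :
    (pair m).pair (V.d n m x) y = (pair n).pair x (U.d (-m) (-n) y)

namespace ComplexDualPair

variable {V V' : CochainComplex (ModuleCat.{u} R) ℤ} {U U' : CochainComplex (ModuleCat.{u} Rᵐᵒᵖ) ℤ}
  (D : ComplexDualPair V U) (D' : ComplexDualPair V' U')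

section

variable {k : Type w} [CommRing k] [Algebra k R] (I : ModuleCat.{u} k)

/-- The trace forms defined by a degreewise duality. -/
def complexTrace : ComplexTrace I V ((contravariantCochain (star I R)).obj (op U)) where
  -- The sign turns adjointness of the differentials into the anticommutation required by `tr_d`.
  tr n := n.negOnePow • (D.pair n).tr
  isPerfect n Y := ((D.pair n).isPerfect_tr Y).units_smul _
  tr_d n a := by
    have h := (D.pair n).tr_comp_map_star (D.pair (n + 1)) _ _ (D.pair_d n (n + 1)) a
    change (n + 1).negOnePow •
      (D.pair (n + 1)).tr (a ≫ (star I R).map (U.d (-(n + 1)) (-n)).op) =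
        -(n.negOnePow • (D.pair n).tr (V.d n (n + 1) ≫ a))
    rw [Int.negOnePow_succ, Units.neg_smul]
    exact congrArg (fun x : I ↦ -(n.negOnePow • x)) h

lemma complexTrace_tr_comp_map (f : V ⟶ V') (f' : U' ⟶ U)
    (h : ∀ n x y, (D'.pair n).pair (f.f n x) y = (D.pair n).pair x (f'.f (-n) y)) (n : ℤ)
    (b : V'.X n ⟶ ((contravariantCochain (star I R)).obj (op U)).X n) :
    (D'.complexTrace I).tr n (b ≫ ((contravariantCochain (star I R)).map f'.op).f n) =
      (D.complexTrace I).tr n (f.f n ≫ b) := by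
  have := (D.pair n).tr_comp_map_star (D'.pair n) _ _ (h n) b
  exact congrArg (fun x : I ↦ n.negOnePow • x) this

end

include D in
/-- The complex `Hom(V, A)` is exact in degree `m`, for `A` projective, if the dual of `V` is exact
in degree `-m`. -/
lemma homExactAt (A : ModuleCat.{u} R) [Projective A] (m : ℤ) (hU : U.ExactAt (-m)) :
    V.HomExactAt A m := by
  intro u hu
  have hA : Module.Projective R A := (IsProjective.iff_projective A).2 inferInstance
  -- `A` need not be finitely generated, so it is embedded into the free module on its elements; the
  -- image of `u` only involves finitely many coordinates because `V.X m` is finitely generated.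
  obtain ⟨s, hs⟩ := Module.projective_def.1 hA
  have hu' (x) : u (V.d (m - 1) m x) = 0 := ConcreteCategory.congr_hom hu x
  have hUex (y : U.X (-m)) (hy : U.d (-m) (-(m - 1)) y = 0) :
      ∃ z : U.X (-(m + 1)), U.d (-(m + 1)) (-m) z = y := by
    rw [U.exactAt_iff' (-(m + 1)) (-m) (-(m - 1)) (by rw [CochainComplex.prev]; omega)
      (by rw [CochainComplex.next]; omega), ShortComplex.moduleCat_exact_iff] at hU
    exact hU y hy
  let D₀ := D.pair m
  let a (i : Fin D₀.n) : A := u (D₀.v i)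
  have hua (x : V.X m) : u x = ∑ i, D₀.pair x (D₀.u i) • a i := by
    conv_lhs => rw [← D₀.sum_left x, map_sum]
    simp only [map_smul, a]
  classical
  let T : Finset A := Finset.univ.biUnion fun i ↦ (s (a i)).support
  have hsu (x : V.X m) (b : A) : s (u x) b = ∑ i, D₀.pair x (D₀.u i) * s (a i) b := by
    rw [hua, map_sum, Finsupp.finsetSum_apply]
    simp
  have hT (x : V.X m) : (s (u x)).support ⊆ T := by
    intro b hb
    by_contra hb'
    refine (Finsupp.mem_support_iff.1 hb) ?_
    rw [hsu]
    refine Finset.sum_eq_zero fun i _ ↦ ?_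
    have : s (a i) b = 0 := by
      by_contra h
      exact hb' (Finset.mem_biUnion.2 ⟨i, Finset.mem_univ i, Finsupp.mem_support_iff.2 h⟩)
    rw [this, mul_zero]
  -- The `b`-th coordinate of `u`, as an element of the dual. It is a cycle because `u` kills
  -- boundaries, so exactness of `U` writes it as a boundary; reassembling the preimages gives the
  -- factorization.
  let y (b : A) : U.X (-m) := ∑ i, MulOpposite.op (s (a i) b) • D₀.u i
  have hy (x : V.X m) (b : A) : D₀.pair x (y b) = s (u x) b := by
    rw [hsu, D₀.pair_sum_right]
    simp only [D₀.pair_smul_right]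
  have hy' (b : A) : U.d (-m) (-(m - 1)) (y b) = 0 := by
    refine (D.pair (m - 1)).eq_zero_right fun x ↦ ?_
    rw [← D.pair_d]
    exact (hy _ b).trans (by rw [hu', map_zero, Finsupp.zero_apply])
  choose z hz using fun b ↦ hUex (y b) (hy' b)
  refine ⟨∑ b ∈ T, (D.pair (m + 1)).toHom b (z b), ?_⟩
  ext x
  rw [Preadditive.comp_sum, ModuleCat.hom_sum, LinearMap.sum_apply]
  refine Eq.trans ?_ (hs (u x))
  rw [Finsupp.linearCombination_apply, Finsupp.sum_of_support_subset _ (hT x) _ (by simp)]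
  refine Finset.sum_congr rfl fun b _ ↦ ?_
  have h : (D.pair (m + 1)).pair (V.d m (m + 1) x) (z b) = s (u x) b := by
    rw [D.pair_d, hz, ← hy]
  exact congrArg (· • b) h

end ComplexDualPair

/-- The duality between a complex `P` of finitely generated projective modules and `P^∨`. -/
noncomputable def complexDualPair (P : CochainComplex (ModuleCat.{u} R) ℤ)
    [∀ n, Projective (P.X n)] [∀ n, Module.Finite R (P.X n)] :
    ComplexDualPair P ((contravariantCochain (homInto R Rᵐᵒᵖ R)).obj (op P)) where
  -- The dual complex in degree `-n` is the dual of the term in degree `-(-n)`, which equals `n`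
  -- only propositionally.
  pair n := (dualPair (P.X (-(-n)))).ofIso (P.XIsoOfEq (neg_neg n).symm)
  pair_d n m x φ := by
    change veeEval φ ((P.d n m ≫ (P.XIsoOfEq (neg_neg m).symm).hom) x) =
      veeEval φ (((P.XIsoOfEq (neg_neg n).symm).hom ≫ P.d (-(-n)) (-(-m))) x)
    rw [HomologicalComplex.d_comp_XIsoOfEq_hom, HomologicalComplex.XIsoOfEq_hom_comp_d]

/-- The duality between `U^∨` and a complex `U` of finitely generated projective right modules. -/
noncomputable def complexDualPairOp (U : CochainComplex (ModuleCat.{u} Rᵐᵒᵖ) ℤ)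
    [∀ n, Projective (U.X n)] [∀ n, Module.Finite Rᵐᵒᵖ (U.X n)] :
    ComplexDualPair ((contravariantCochain (homInto Rᵐᵒᵖ R R)).obj (op U)) U where
  pair n := dualPairOp (U.X (-n))
  pair_d _ _ _ _ := rfl

lemma complexDualPair_map {P P' : CochainComplex (ModuleCat.{u} R) ℤ}
    [∀ n, Projective (P.X n)] [∀ n, Module.Finite R (P.X n)]
    [∀ n, Projective (P'.X n)] [∀ n, Module.Finite R (P'.X n)] (f : P ⟶ P') (n : ℤ) (x : P.X n)
    (φ : ((contravariantCochain (homInto R Rᵐᵒᵖ R)).obj (op P')).X (-n)) :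
    ((complexDualPair P').pair n).pair (f.f n x) φ = ((complexDualPair P).pair n).pair x
      (((contravariantCochain (homInto R Rᵐᵒᵖ R)).map f.op).f (-n) φ) := by
  change veeEval φ ((f.f n ≫ (P'.XIsoOfEq (neg_neg n).symm).hom) x) =
    veeEval φ (((P.XIsoOfEq (neg_neg n).symm).hom ≫ f.f (-(-n))) x)
  rw [HomologicalComplex.XIsoOfEq_hom_naturality]

lemma complexDualPairOp_map {U U' : CochainComplex (ModuleCat.{u} Rᵐᵒᵖ) ℤ}
    [∀ n, Projective (U.X n)] [∀ n, Module.Finite Rᵐᵒᵖ (U.X n)]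
    [∀ n, Projective (U'.X n)] [∀ n, Module.Finite Rᵐᵒᵖ (U'.X n)] (f : U ⟶ U') (n : ℤ)
    (φ : ((contravariantCochain (homInto Rᵐᵒᵖ R R)).obj (op U')).X n) (x : U.X (-n)) :
    ((complexDualPairOp U).pair n).pair (((contravariantCochain (homInto Rᵐᵒᵖ R R)).map f.op).f n φ)
      x = ((complexDualPairOp U').pair n).pair φ (f.f (-n) x) := rfl

end DualPair

section Star

variable {k : Type w} [CommRing k] (I : ModuleCat.{u} k) [Injective I] (R : Type u) [Ring R]
  [Algebra k R]

/-- Exactness only concerns the underlying `k`-modules, where it is the extension property of `I`;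
the extension is automatically an element of the dual module. -/
instance preservesHomology_star : (star I R).PreservesHomology :=
  Functor.preservesHomology_of_map_exact _ fun S hS ↦ by
    replace hS := hS.unop
    rw [ShortComplex.moduleCat_exact_iff] at hS ⊢
    intro φ hφ
    let g : S.X₂.unop →ₗ[k] S.X₁.unop :=
      { S.f.unop.hom with
        map_smul' c x := map_smul S.f.unop.hom (algebraMap k Rᵐᵒᵖ c) x }
    obtain ⟨ψ, hψ⟩ := exists_comp_eq_of_ker_le g (show S.X₂.unop →ₗ[k] I from φ) (fun x hx ↦ by
      obtain ⟨y, rfl⟩ := hS x hx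
      exact LinearMap.congr_fun hφ y)
    exact ⟨ψ, LinearMap.ext hψ⟩

lemma quasiIso_contravariantCochain_star {K L : CochainComplex (ModuleCat.{u} Rᵐᵒᵖ) ℤ} (f : K ⟶ L)
    [QuasiIso f] : QuasiIso ((contravariantCochain (star I R)).map f.op) := by
  have := (CochainComplex.quasiIso_opEquivalence_map_iff f).2 inferInstance
  exact HomologicalComplex.quasiIso_map_of_preservesHomology
    ((CochainComplex.opEquivalence _).functor.map f.op) (star I R)

end Star

end PartialSerre

/-! ### Pairings on full subcategories, and functorial resolutions -/

namespace PartialSerre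

open CochainComplex Limits HomotopyCategory

section Perfect

universe v₁ u₁ v₂ u₂ v₃

variable {k : Type w} [CommRing k] {I : ModuleCat.{v₃} k}
variable {T : Type u₁} [Category.{v₁} T] [Preadditive T] [Linear k T]

lemma bijective_comp_of_linearMap {A B M : Type*} [AddCommGroup A] [Module k A] [AddCommGroup B]
    [Module k B] [AddCommGroup M] [Module k M] (θ : A →ₗ[k] B) (hθ : Function.Bijective θ) :
    Function.Bijective (fun φ : B →ₗ[k] M ↦ φ ∘ₗ θ) :=
  ((LinearEquiv.ofBijective θ hθ).arrowCongr (LinearEquiv.refl k M)).symm.bijective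

variable {P : ObjectProperty T}

instance : P.ι.Linear k where

/-- Restriction of a perfect pairing along a reflection morphism. -/
lemma isPerfect_of_bijective_comp_map {X : T} {L S Y : P.FullSubcategory} (t : (X ⟶ S.obj) →ₗ[k] I)
    (η : X ⟶ L.obj) (hη : Function.Bijective (fun f : L ⟶ Y ↦ η ≫ P.ι.map f))
    (ht : IsPerfect t Y.obj) :
    IsPerfect (t ∘ₗ Linear.leftComp k S.obj η ∘ₗ P.ι.mapLinearMap k (X := L) (Y := S)) Y := by
  let θ : (L ⟶ Y) →ₗ[k] (X ⟶ Y.obj) :=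
    Linear.leftComp k Y.obj η ∘ₗ P.ι.mapLinearMap k (X := L) (Y := Y)
  have h : (pairing (t ∘ₗ Linear.leftComp k S.obj η ∘ₗ P.ι.mapLinearMap k (X := L) (Y := S)) Y :
      (Y ⟶ S) → _) = fun g ↦ pairing t Y.obj (P.ι.map g) ∘ₗ θ := by
    ext g a
    change t (η ≫ P.ι.map (a ≫ g)) = t ((η ≫ P.ι.map a) ≫ P.ι.map g)
    rw [P.ι.map_comp, Category.assoc]
  unfold IsPerfect
  rw [h]
  exact (bijective_comp_of_linearMap (M := I) θ hη).comp
    (ht.comp (P.fullyFaithfulι.homEquiv (X := Y) (Y := S)).bijective)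

/-- Perfect pairings induced by pairings with an object that has a coreflection `S`. -/
lemma isPerfect_of_bijective_comp_counit {Z : T} {L S Y : P.FullSubcategory}
    (t : (L.obj ⟶ Z) →ₗ[k] I) (ε : S.obj ⟶ Z)
    (hε : Function.Bijective (fun f : Y ⟶ S ↦ P.ι.map f ≫ ε))
    (ht : Function.Bijective (fun β : Y.obj ⟶ Z ↦ t ∘ₗ Linear.rightComp k L.obj β)) :
    IsPerfect (t ∘ₗ Linear.rightComp k L.obj ε ∘ₗ P.ι.mapLinearMap k (X := L) (Y := S)) Y := by
  let θ : (L ⟶ Y) →ₗ[k] (L.obj ⟶ Y.obj) := P.ι.mapLinearMap k (X := L) (Y := Y)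
  have h : (pairing (t ∘ₗ Linear.rightComp k L.obj ε ∘ₗ P.ι.mapLinearMap k (X := L) (Y := S)) Y :
      (Y ⟶ S) → _) =
        fun g ↦ (t ∘ₗ Linear.rightComp k L.obj (P.ι.map g ≫ ε)) ∘ₗ θ := by
    ext g a
    change t (P.ι.map (a ≫ g) ≫ ε) = t (P.ι.map a ≫ P.ι.map g ≫ ε)
    rw [P.ι.map_comp, Category.assoc]
  unfold IsPerfect
  rw [h]
  exact (bijective_comp_of_linearMap (M := I) θ
    (P.fullyFaithfulι.homEquiv (X := L) (Y := Y)).bijective).comp (ht.comp hε)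

end Perfect

section Resolution

lemma conj_comp_eq {T : Type*} [Category* T] {A A' B B' C C' : T} {e : A ≅ B} {e' : A' ≅ B'}
    {g : A ⟶ A'} {p : B ⟶ C} {p' : B' ⟶ C'} {f : C ⟶ C'} {ε : A ⟶ C} {ε' : A' ⟶ C'}
    (h : e.hom ≫ p = ε) (h' : e'.hom ≫ p' = ε') (hg : g ≫ ε' = ε ≫ f) :
    (e.inv ≫ g ≫ e'.hom) ≫ p' = p ≫ f := by
  rw [Category.assoc, Category.assoc, h', Iso.inv_comp_eq, hg, ← h, Category.assoc]

variable {R : Type u} [Ring R]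

/-- A resolution of a bounded complex by a right bounded complex of finitely generated projective
modules. -/
structure Resolution (X : CochainComplex (ModuleCat.{u} R) ℤ) where
  /-- the complex of finitely generated projective modules -/
  P : CochainComplex (ModuleCat.{u} R) ℤ
  /-- the quasi-isomorphism -/
  p : P ⟶ X
  /-- a lower bound for `X` -/
  a : ℤ
  /-- an upper bound for `P` and `X` -/
  b : ℤ
  isStrictlyGE : X.IsStrictlyGE a
  isStrictlyLE : X.IsStrictlyLE b
  isStrictlyLE_P : P.IsStrictlyLE b
  projective (n : ℤ) : Projective (P.X n)
  finite (n : ℤ) : Module.Finite R (P.X n)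
  quasiIso : QuasiIso p

namespace Resolution

attribute [instance] isStrictlyGE isStrictlyLE isStrictlyLE_P projective finite quasiIso

variable {X : CochainComplex (ModuleCat.{u} R) ℤ} (r : Resolution X)

include r in
lemma isBounded : IsBounded X :=
  ⟨r.a, r.b, fun n hn ↦ hn.elim (fun h ↦ X.isZero_of_isStrictlyGE r.a n h)
    (fun h ↦ X.isZero_of_isStrictlyLE r.b n h)⟩

/-- The resolution has the cohomology of `X`. This is the source of the exactness of `Hom(P^∨, A)`
in high degrees. -/
lemma exactAt (n : ℤ) (hn : n < r.a) : r.P.ExactAt n :=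
  (quasiIsoAt_iff_exactAt' r.p n
    (ShortComplex.exact_of_isZero_X₂ _ (X.isZero_of_isStrictlyGE r.a n hn))).1 inferInstance

end Resolution

lemma Kbfpr.nonempty_resolution {X : KMod R} (hX : Kbfpr R X) : Nonempty (Resolution X.as) := by
  obtain ⟨⟨a, b, ha, hb⟩, P, f, ⟨n, hn⟩, hP, hf⟩ := hX
  exact ⟨
    { P := P
      p := f
      a := a
      b := max b n
      isStrictlyGE := ha
      isStrictlyLE := isStrictlyLE_of_le _ b (max b n) (le_max_left _ _)
      isStrictlyLE_P := isStrictlyLE_of_le _ n (max b n) (le_max_right _ _)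
      projective i := (hP i).1
      finite i := (hP i).2
      quasiIso := hf }⟩

/-- A chosen resolution. -/
noncomputable def resolution (X : (Kbfpr R).FullSubcategory) : Resolution X.obj.as :=
  X.property.nonempty_resolution.some

variable (hrho : Kbfpr R ≤ RhoDefined R)

/-- `ρ X` is defined by a universal property only; replacing it by a complex of finitely generated
projectives gives access to dual bases. -/
lemma exists_iso_rho (X : (Kbfpr R).FullSubcategory) :
    ∃ e : (rho hrho ⋙ (KProj R).ι).obj X ≅ (quotient _ _).obj (resolution X).P,
      e.hom ≫ (quotient _ _).map (resolution X).p =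
        (KProj R).ι.partialRightAdjointCounit ((ObjectProperty.ιOfLE hrho).obj X) := by
  obtain ⟨e, he⟩ := (KProj R).ι.exists_iso_partialRightAdjointObj
    ((ObjectProperty.ιOfLE hrho).obj X) ⟨(quotient _ _).obj (resolution X).P,
      (resolution X).projective⟩ ((quotient _ _).map (resolution X).p)
      (bijective_comp_of_quasiIso (resolution X).p (resolution X).b (resolution X).projective)
  exact ⟨(KProj R).ι.mapIso e, he⟩

/-- The functor sending a complex to its chosen resolution. -/
noncomputable def resolutionFunctor : (Kbfpr R).FullSubcategory ⥤ KMod R :=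
  (rho hrho ⋙ (KProj R).ι).copyObj (fun X ↦ (quotient _ _).obj (resolution X).P)
    fun X ↦ (exists_iso_rho hrho X).choose

/-- The resolution functor is isomorphic to `ρ`. -/
noncomputable def resolutionFunctorIso : rho hrho ⋙ (KProj R).ι ≅ resolutionFunctor hrho :=
  Functor.isoCopyObj _ _ _

lemma resolutionFunctor_map_comp {X X' : (Kbfpr R).FullSubcategory} (f : X ⟶ X') :
    (resolutionFunctor hrho).map f ≫ (quotient _ _).map (resolution X').p =
      (quotient _ _).map (resolution X).p ≫ f.hom := by
  change ((exists_iso_rho hrho X).choose.inv ≫ (rho hrho ⋙ (KProj R).ι).map f ≫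
    (exists_iso_rho hrho X').choose.hom) ≫ (quotient _ _).map (resolution X').p = _
  exact conj_comp_eq (exists_iso_rho hrho X).choose_spec (exists_iso_rho hrho X').choose_spec
    ((KProj R).ι.map_partialRightAdjointMap_counit ((ObjectProperty.ιOfLE hrho).map f))

end Resolution

end PartialSerre

namespace PartialSerre

open CochainComplex Limits HomotopyCategory

/-! ### The partial Serre functor on `K(Inj R)` -/

section KInj

variable {k : Type w} [CommRing k] (I : ModuleCat.{u} k) [Injective I] {R : Type u} [Ring R]
  [Algebra k R] (hlam : Kbfpr R ≤ LamDefined R) (hrho : Kbfpr R ≤ RhoDefined R)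

namespace Resolution

variable {X : CochainComplex (ModuleCat.{u} R) ℤ} (r : Resolution X)

/-- The trace forms between `P` and `ν P`, for a resolution `P`. -/
noncomputable def trace : ComplexTrace I r.P ((contravariantCochain (star I R)).obj
    (op ((contravariantCochain (homInto R Rᵐᵒᵖ R)).obj (op r.P)))) :=
  (complexDualPair r.P).complexTrace I

end Resolution

lemma injective_contravariantCochain_star {V : CochainComplex (ModuleCat.{u} R) ℤ}
    {U : CochainComplex (ModuleCat.{u} Rᵐᵒᵖ) ℤ} (D : ComplexDualPair V U) (n : ℤ) :
    Injective (((contravariantCochain (star I R)).obj (op U)).X n) :=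
  injective_of_isPerfect ((D.complexTrace I).isPerfect n)

/-- The functor `X ↦ ν ρ X`, with values in `K(Inj R)`. -/
noncomputable def nuRho : (Kbfpr R).FullSubcategory ⥤ (KInj R).FullSubcategory :=
  (KInj R).lift (resolutionFunctor hrho ⋙ nuK R I) fun X ↦
    injective_contravariantCochain_star I (complexDualPair (resolution X).P)

lemma exists_nuRho_map_eq {X X' : (Kbfpr R).FullSubcategory} (f : X ⟶ X') :
    ∃ g : (resolution X).P ⟶ (resolution X').P,
      (quotient _ _).map g = (resolutionFunctor hrho).map f ∧
      (quotient _ _).map ((contravariantCochain (star I R)).map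
        ((contravariantCochain (homInto R Rᵐᵒᵖ R)).map g.op).op) =
          ((nuRho I hrho).map f).hom := by
  obtain ⟨g, hg⟩ := (quotient _ _).map_surjective ((resolutionFunctor hrho).map f)
  refine ⟨g, hg, ?_⟩
  change _ = (nuK R I).map ((resolutionFunctor hrho).map f)
  rw [← hg]
  rfl

/-- The unit `X ⟶ λ X`. -/
noncomputable def lamUnit (X : (Kbfpr R).FullSubcategory) : X.obj ⟶ ((lam hlam).obj X).obj :=
  (KInj R).ι.partialLeftAdjointUnit ((ObjectProperty.ιOfLE hlam).obj X)

lemma lamUnit_naturality {X X' : (Kbfpr R).FullSubcategory} (f : X ⟶ X') :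
    lamUnit hlam X ≫ ((lam hlam).map f).hom = f.hom ≫ lamUnit hlam X' :=
  (KInj R).ι.partialLeftAdjointUnit_map ((ObjectProperty.ιOfLE hlam).map f)

/-- The linear form on morphisms `X ⟶ ν ρ X` given by the resolution. -/
noncomputable def nuRhoForm (X : (Kbfpr R).FullSubcategory) :
    (X.obj ⟶ ((nuRho I hrho).obj X).obj) →ₗ[k] I :=
  ((resolution X).trace I).pairKLeft (resolution X).isBounded
    ((quotient _ _).map (resolution X).p)

/-- Moving the chain map `g` across the trace replaces `p'` by `g ≫ p'`, which is `p ≫ f` up to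
homotopy; associativity of the pairing moves `f` to the other side. -/
lemma nuRhoForm_comp_map {X X' : (Kbfpr R).FullSubcategory} (f : X ⟶ X')
    (a : X'.obj ⟶ ((nuRho I hrho).obj X).obj) :
    nuRhoForm I hrho X' (a ≫ ((nuRho I hrho).map f).hom) = nuRhoForm I hrho X (f.hom ≫ a) := by
  obtain ⟨g, hg, hg'⟩ := exists_nuRho_map_eq I hrho f
  rw [← hg']
  refine (((resolution X).trace I).pairK_comp_map ((resolution X').trace I)
    (resolution X').isBounded g _ ((complexDualPair _).complexTrace_tr_comp_map
      (complexDualPair _) I g _ (complexDualPair_map g)) ((quotient _ _).map (resolution X').p)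
        a).trans ?_
  refine (congrArg (fun x ↦ ((resolution X).trace I).pairK x a)
    ((congrArg (· ≫ (quotient _ _).map (resolution X').p) hg).trans
      (resolutionFunctor_map_comp hrho f))).trans ?_
  exact ((resolution X).trace I).pairK_comp (resolution X).isBounded (resolution X').isBounded
    ((quotient _ _).map (resolution X).p) f.hom a

/-- The dinatural perfect pairings between `λ X` and `ν ρ X`. -/
noncomputable def serreTraceKInj : SerreTrace I (lam hlam) (nuRho I hrho) where
  tr X := nuRhoForm I hrho X ∘ₗ Linear.leftComp k _ (lamUnit hlam X) ∘ₗ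
    (KInj R).ι.mapLinearMap k (X := (lam hlam).obj X) (Y := (nuRho I hrho).obj X)
  tr_comp_map {X X'} f a := by
    change nuRhoForm I hrho X' (lamUnit hlam X' ≫ a.hom ≫ ((nuRho I hrho).map f).hom) =
      nuRhoForm I hrho X (lamUnit hlam X ≫ ((lam hlam).map f).hom ≫ a.hom)
    rw [← Category.assoc, nuRhoForm_comp_map, ← Category.assoc, ← Category.assoc,
      lamUnit_naturality]
  isPerfect X Y := by
    refine isPerfect_of_bijective_comp_map _ _
      ((KInj R).ι.bijective_partialLeftAdjointUnit_comp _ Y) ?_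
    have (n : ℤ) : Injective (Y.obj.as.X n) := Y.property n
    exact ((resolution X).trace I).bijective_pairK_of_injective (J := Y.obj.as)
      (resolution X).isBounded (resolution X).b (resolution X).p

end KInj

/-! ### The partial Serre functor on `K(Proj R)` -/

section KProj

variable {k : Type w} [CommRing k] (I : ModuleCat.{u} k) {R : Type u} [Ring R]
  [Algebra k R] (hrho : Kbfpr Rᵐᵒᵖ ≤ RhoDefined Rᵐᵒᵖ)

/-- The dual of a bounded below complex is bounded above, hence has a projective resolution. -/
lemma rhoDefined_star (X : (Kbfpr Rᵐᵒᵖ).FullSubcategoryᵒᵖ) :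
    RhoDefined R (((Kbfpr Rᵐᵒᵖ).ι.op ⋙ starK R I).obj X) := by
  refine rhoDefined_of_isStrictlyLE _ (-(resolution X.unop).a) ?_
  rw [isStrictlyLE_iff]
  exact fun n hn ↦ isZero_contravariantCochain_X _ _ _
    (isZero_of_isStrictlyGE X.unop.obj.as (resolution X.unop).a _ (by omega))

namespace Resolution

variable {X : CochainComplex (ModuleCat.{u} Rᵐᵒᵖ) ℤ} (r : Resolution X)

/-- The trace forms between `P^∨` and `P^*`, for a resolution `P`. -/
noncomputable def traceOp : ComplexTrace I
    ((contravariantCochain (homInto Rᵐᵒᵖ R R)).obj (op r.P))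
    ((contravariantCochain (star I R)).obj (op r.P)) :=
  (complexDualPairOp r.P).complexTrace I

include r in
lemma isBounded_star : IsBounded ((contravariantCochain (star I R)).obj (op X)) :=
  ⟨-r.b, -r.a, fun n hn ↦ isZero_contravariantCochain_X _ _ _ (hn.elim
    (fun h ↦ X.isZero_of_isStrictlyLE r.b _ (by omega))
    (fun h ↦ X.isZero_of_isStrictlyGE r.a _ (by omega)))⟩

end Resolution

/-- The functor `X ↦ (ρ X)^∨`, with values in `K(Proj R)`. -/
noncomputable def veeRho : (Kbfpr Rᵐᵒᵖ).FullSubcategoryᵒᵖ ⥤ (KProj R).FullSubcategory :=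
  (KProj R).lift ((resolutionFunctor hrho).op ⋙ veeOpK R) fun X n ↦
    ((complexDualPairOp (resolution X.unop).P).pair n).projective_left

/-- `veeRho` is isomorphic to `X ↦ (ρ X)^∨`. -/
noncomputable def veeRhoIso : veeRho hrho ⋙ (KProj R).ι ≅
    (rho hrho ⋙ (KProj Rᵐᵒᵖ).ι).op ⋙ veeOpK R :=
  Functor.isoWhiskerRight (NatIso.op (resolutionFunctorIso hrho)) (veeOpK R)

lemma traceOp_pairK_comp_starK {X X' : CochainComplex (ModuleCat.{u} Rᵐᵒᵖ) ℤ}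
    {Z : CochainComplex (ModuleCat.{u} R) ℤ} (r : Resolution X)
    (r' : Resolution X') (hZ : IsBounded Z)
    (f : (quotient _ (ComplexShape.up ℤ)).obj r'.P ⟶ (quotient _ _).obj r.P)
    (p : (veeOpK R).obj (op ((quotient _ (ComplexShape.up ℤ)).obj r'.P)) ⟶ (quotient _ _).obj Z)
    (c : (quotient _ _).obj Z ⟶ (starK R I).obj (op ((quotient _ (ComplexShape.up ℤ)).obj r.P))) :
    (r'.traceOp I).pairK p (c ≫ (starK R I).map f.op) =
      (r.traceOp I).pairK ((veeOpK R).map f.op ≫ p) c := by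
  obtain ⟨f, rfl⟩ := (quotient _ _).map_surjective f
  exact (r.traceOp I).pairK_comp_map (r'.traceOp I) hZ
    ((contravariantCochain (homInto Rᵐᵒᵖ R R)).map f.op)
    ((contravariantCochain (star I R)).map f.op)
    ((complexDualPairOp r.P).complexTrace_tr_comp_map (complexDualPairOp r'.P) I _ f
      (complexDualPairOp_map f)) p c

/-- The functor `X ↦ ρ (X^*)`. -/
noncomputable def rhoStar : (Kbfpr Rᵐᵒᵖ).FullSubcategoryᵒᵖ ⥤ (KProj R).FullSubcategory :=
  (RhoDefined R).lift ((Kbfpr Rᵐᵒᵖ).ι.op ⋙ starK R I) (rhoDefined_star I) ⋙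
    (KProj R).ι.partialRightAdjoint

/-- The counit `ρ (X^*) ⟶ X^*`. -/
noncomputable def rhoStarCounit (X : (Kbfpr Rᵐᵒᵖ).FullSubcategoryᵒᵖ) :
    ((rhoStar I).obj X).obj ⟶ (starK R I).obj (op X.unop.obj) :=
  (KProj R).ι.partialRightAdjointCounit
    (((RhoDefined R).lift ((Kbfpr Rᵐᵒᵖ).ι.op ⋙ starK R I) (rhoDefined_star I)).obj X)

lemma rhoStarCounit_naturality {X X' : (Kbfpr Rᵐᵒᵖ).FullSubcategoryᵒᵖ} (f : X ⟶ X') :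
    ((rhoStar I).map f).hom ≫ rhoStarCounit I X' =
      rhoStarCounit I X ≫ (starK R I).map f.unop.hom.op :=
  (KProj R).ι.map_partialRightAdjointMap_counit
    (((RhoDefined R).lift ((Kbfpr Rᵐᵒᵖ).ι.op ⋙ starK R I) (rhoDefined_star I)).map f)

/-- The linear form on morphisms `(ρ X)^∨ ⟶ X^*` given by the resolution. -/
noncomputable def veeRhoForm (X : (Kbfpr Rᵐᵒᵖ).FullSubcategoryᵒᵖ) :
    (((veeRho hrho).obj X).obj ⟶ (starK R I).obj (op X.unop.obj)) →ₗ[k] I :=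
  ((resolution X.unop).traceOp I).pairKRight ((resolution X.unop).isBounded_star I)
    ((quotient _ _).map ((contravariantCochain (star I R)).map (resolution X.unop).p.op))

/-- Dualizing the naturality square of the resolutions moves `f^*` past `X^* ⟶ P^*`, and the trace
then exchanges the induced maps on `P^*` and on `P^∨`. -/
lemma veeRhoForm_comp_map {X X' : (Kbfpr Rᵐᵒᵖ).FullSubcategoryᵒᵖ} (f : X ⟶ X')
    (a : ((veeRho hrho).obj X').obj ⟶ (starK R I).obj (op X.unop.obj)) :
    veeRhoForm I hrho X' (a ≫ (starK R I).map f.unop.hom.op) =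
      veeRhoForm I hrho X (((veeRho hrho).map f).hom ≫ a) := by
  refine (((resolution X'.unop).traceOp I).pairK_comp ((resolution X.unop).isBounded_star I)
    ((resolution X'.unop).isBounded_star I) a ((starK R I).map f.unop.hom.op) _).trans ?_
  have h : (starK R I).map f.unop.hom.op ≫ (starK R I).map
      ((quotient _ _).map (resolution X'.unop).p).op = (starK R I).map
      ((quotient _ _).map (resolution X.unop).p).op ≫
        (starK R I).map ((resolutionFunctor hrho).map f.unop).op :=
    ((starK R I).map_comp _ _).symm.trans ((congrArg (fun g ↦ (starK R I).map (Quiver.Hom.op g))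
      (resolutionFunctor_map_comp hrho f.unop).symm).trans ((starK R I).map_comp _ _))
  refine (congrArg (((resolution X'.unop).traceOp I).pairK a) h).trans ?_
  exact traceOp_pairK_comp_starK I (resolution X.unop) (resolution X'.unop)
    ((resolution X.unop).isBounded_star I) _ _ _

lemma bijective_veeRhoForm [Injective I] (X : (Kbfpr Rᵐᵒᵖ).FullSubcategoryᵒᵖ) (Y : (KProj R).FullSubcategory) :
    Function.Bijective (fun β : Y.obj ⟶ (starK R I).obj (op X.unop.obj) ↦
      veeRhoForm I hrho X ∘ₗ Linear.rightComp k ((veeRho hrho).obj X).obj β) := by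
  have (n : ℤ) : Projective (Y.obj.as.X n) := Y.property n
  let r := resolution X.unop
  have := quasiIso_contravariantCochain_star I R r.p
  have : ((contravariantCochain (homInto Rᵐᵒᵖ R R)).obj (op r.P)).IsStrictlyGE (-r.b) := by
    rw [isStrictlyGE_iff]
    exact fun n hn ↦ isZero_contravariantCochain_X _ _ _
      (r.P.isZero_of_isStrictlyLE r.b _ (by omega))
  exact (r.traceOp I).bijective_pairK_of_projective (Y := Y.obj.as) (r.isBounded_star I) (-r.b)
    -- Exactness of `Hom(P^∨, A)` in degree `m` comes from that of `P` in degree `-m`, available for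
    -- `-m < a`, that is `-a + 1 ≤ m`.
    ((contravariantCochain (star I R)).map r.p.op) (-r.a + 1) fun A m _ hm ↦
      (complexDualPairOp r.P).homExactAt A m (r.exactAt _ (by omega))

/-- The dinatural perfect pairings between `(ρ X)^∨` and `ρ (X^*)`. -/
noncomputable def serreTraceKProj [Injective I] : SerreTrace I (veeRho hrho) (rhoStar I) where
  tr X := veeRhoForm I hrho X ∘ₗ Linear.rightComp k _ (rhoStarCounit I X) ∘ₗ
    (KProj R).ι.mapLinearMap k (X := (veeRho hrho).obj X) (Y := (rhoStar I).obj X)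
  tr_comp_map {X X'} f a := by
    change veeRhoForm I hrho X' ((a.hom ≫ ((rhoStar I).map f).hom) ≫ rhoStarCounit I X') =
      veeRhoForm I hrho X ((((veeRho hrho).map f).hom ≫ a.hom) ≫ rhoStarCounit I X)
    rw [Category.assoc, rhoStarCounit_naturality, ← Category.assoc, veeRhoForm_comp_map,
      ← Category.assoc]
  isPerfect X Y := isPerfect_of_bijective_comp_counit _ _
    ((KProj R).ι.bijective_comp_partialRightAdjointCounit Y _) (bijective_veeRhoForm I hrho X Y)

end KProj

end PartialSerre

theorem mainTheorem4 {k : Type w} [CommRing k] (I : ModuleCat.{u} k) [Injective I]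
    (hI : IsCoseparator I) (R : Type u) [Ring R] [Algebra k R] :
    (∃ (hlam : PartialSerre.Kbfpr R ≤ PartialSerre.LamDefined R)
        (hrho : PartialSerre.Kbfpr R ≤ PartialSerre.RhoDefined R)
        (S : PartialSerre.PartialSerreFunctor k I (PartialSerre.lam hlam).essImage),
        Nonempty ((PartialSerre.lam hlam).toEssImage ⋙ S.functor ⋙ (PartialSerre.KInj R).ι ≅
          PartialSerre.rho hrho ⋙ (PartialSerre.KProj R).ι ⋙ PartialSerre.nuK R I)) ∧
    (∃ (hrho : PartialSerre.Kbfpr Rᵐᵒᵖ ≤ PartialSerre.RhoDefined Rᵐᵒᵖ)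
        (hstar : ∀ X : (PartialSerre.Kbfpr Rᵐᵒᵖ).FullSubcategoryᵒᵖ,
          PartialSerre.RhoDefined R
            (((PartialSerre.Kbfpr Rᵐᵒᵖ).ι.op ⋙ PartialSerre.starK R I).obj X))
        (G : (PartialSerre.Kbfpr Rᵐᵒᵖ).FullSubcategoryᵒᵖ ⥤ (PartialSerre.KProj R).FullSubcategory)
        (_ : G ⋙ (PartialSerre.KProj R).ι ≅
          (PartialSerre.rho hrho ⋙ (PartialSerre.KProj Rᵐᵒᵖ).ι).op ⋙ PartialSerre.veeOpK R)
        (S : PartialSerre.PartialSerreFunctor k I G.essImage),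
        Nonempty (G.toEssImage ⋙ S.functor ≅
          (PartialSerre.RhoDefined R).lift
            ((PartialSerre.Kbfpr Rᵐᵒᵖ).ι.op ⋙ PartialSerre.starK R I) hstar ⋙
            (PartialSerre.KProj R).ι.partialRightAdjoint)) := by
  refine ⟨⟨PartialSerre.kbfpr_le_lamDefined, PartialSerre.kbfpr_le_rhoDefined,
    (PartialSerre.serreTraceKInj I _ PartialSerre.kbfpr_le_rhoDefined).partialSerreFunctor, ⟨?_⟩⟩,
    ⟨PartialSerre.kbfpr_le_rhoDefined, PartialSerre.rhoDefined_star I, PartialSerre.veeRho _,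
      PartialSerre.veeRhoIso _, (PartialSerre.serreTraceKProj I _).partialSerreFunctor,
      ⟨(PartialSerre.serreTraceKProj I _).toEssImageCompFunctorIso⟩⟩⟩
  exact Functor.isoWhiskerRight (PartialSerre.serreTraceKInj I _ _).toEssImageCompFunctorIso
    (PartialSerre.KInj R).ι ≪≫ Functor.isoWhiskerRight
      (PartialSerre.resolutionFunctorIso PartialSerre.kbfpr_le_rhoDefined).symm
      (PartialSerre.nuK R I)
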